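/- **Notation.** For $n\ge 1$, the strip $4_P\times n_F$ of the triangular lattice has the vertices $(j,i)$ with $1\le j\le n$ and $i\in\mathbb Z/4$, and the edges $(j,i)(j,i+1)$ for $1\le j\le n$ and $(j,i)(j+1,i)$, $(j,i)(j+1,i+1)$ for $1\le j<n$; its layer $j$ is the 4-cycle $(j,0)(j,1)(j,2)(j,3)$. Let $W_4=C_4+K_1$ be the 4-wheel, with its rim as distinguished 4-cycle $b_0b_1b_2b_3$. Let $H$ be the 16-vertex plane graph with vertices $a_i,m_i,q_i,t_i$ $(i\in\mathbb Z/4)$ and, for each $i$, the edges $a_ia_{i+1}$, $a_im_i$, $m_ia_{i+1}$, $a_iq_i$, $q_im_i$, $m_iq_{i+1}$, $m_it_i$, $q_it_i$, $t_iq_{i+1}$, $t_it_{i+1}$, together with the one further edge $t_0t_2$ (41 edges in all); its distinguished 4-cycle is $a_0a_1a_2a_3$, which bounds the outer face. For $n\ge 1$ let $X_{H,W_4}(n)$ be the graph obtained from $4_P\times n_F$ by identifying $a_i$ with $(1,i)$ and $b_i$ with $(n,i)$ for $i=0,1,2,3$. Let $P(G,x)$ denote the chromatic polynomial of $G$. **Theorem.**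 The graphs $X_{H,W_4}(n)$ are planar triangulations with real chromatic roots arbitrarily close to $4$. More precisely: 1. For every $n\ge1$, $X_{H,W_4}(n)$ is the graph of a triangulation of the sphere, and $P(X_{H,W_4}(n),4)>0$. 2. There is $\varepsilon_0>0$ such that for every $\varepsilon\in(0,\varepsilon_0)$ there is $n_0$ with $P(X_{H,W_4}(n),4-\varepsilon)<0$ for all $n>n_0$. 3. Consequently, for every $\delta>0$ there is $n_0$ such that for every $n>n_0$ the polynomial $P(X_{H,W_4}(n),x)$ has a real root in the interval $(4-\delta,4)$. In particular there are planar graphs with real chromatic roots arbitrarily close to $4$, as conjectured by Beraha. -/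

import Mathlib

/-! ### Chromatic polynomials -/

/-- The chromatic polynomial: every partition of the vertex set into `s` nonempty independent
sets contributes the falling factorial `x (x - 1) ⋯ (x - s + 1)`. -/
noncomputable def chromaticPolynomial {V : Type*} [Finite V] (G : SimpleGraph V) :
    Polynomial ℤ :=
  ∑ᶠ s : {s : Setoid V // ∀ u v, s u v → ¬ G.Adj u v},
    descPochhammer ℤ (Nat.card (Quotient s.1))

/-- A proper colouring is the same thing as a partition into independent sets together with an
injective assignment of colours to the parts. -/
def coloringEquiv {V : Type*} (G : SimpleGraph V) (C : Type*) :
    G.Coloring C ≃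
      Σ s : {s : Setoid V // ∀ u v, s u v → ¬ G.Adj u v}, (Quotient s.1 ↪ C) where
  toFun f := ⟨⟨Setoid.ker f, fun _ _ h hA => f.valid hA h⟩,
    ⟨Setoid.kerLift f, Setoid.kerLift_injective f⟩⟩
  invFun p := SimpleGraph.Coloring.mk (fun v => p.2 (Quotient.mk p.1.1 v)) (by
    intro u v hA h
    exact p.1.2 u v (Quotient.exact (p.2.injective h)) hA)
  left_inv f := by
    ext v
    rfl
  right_inv p := by
    obtain ⟨⟨s, hs⟩, g⟩ := p
    have key : ∀ (t : Setoid V) (ht : ∀ u v, t u v → ¬ G.Adj u v) (k : Quotient t ↪ C),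
        t = s → (∀ v, k (Quotient.mk t v) = g (Quotient.mk s v)) →
        (⟨⟨t, ht⟩, k⟩ : Σ s : {s : Setoid V // ∀ u v, s u v → ¬ G.Adj u v},
          (Quotient s.1 ↪ C)) = ⟨⟨s, hs⟩, g⟩ := by
      rintro t ht k rfl h
      have : k = g := by
        ext q
        induction q using Quotient.inductionOn with
        | h v => exact h v
      rw [this]
    refine key _ _ _ ?_ (fun v => rfl)
    ext u v
    exact ⟨fun h => Quotient.exact (g.injective h), fun h => congrArg g (Quotient.sound h)⟩

/-- At a natural number `k`, the chromatic polynomial counts the proper colourings with `k`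
colours. -/
theorem chromaticPolynomial_eval {V : Type*} [Finite V] (G : SimpleGraph V) (k : ℕ) :
    (chromaticPolynomial G).eval (k : ℤ) = Nat.card (G.Coloring (Fin k)) := by
  classical
  have : Fintype V := Fintype.ofFinite V
  have : Finite (Setoid V) :=
    Finite.of_injective (fun s : Setoid V => (fun u v => s u v : V → V → Prop))
      (fun s t h => Setoid.ext fun u v => iff_of_eq (congrFun (congrFun h u) v))
  have : Fintype {s : Setoid V // ∀ u v, s u v → ¬ G.Adj u v} := Fintype.ofFinite _
  rw [Nat.card_congr (coloringEquiv G (Fin k)), Nat.card_sigma, chromaticPolynomial,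
    finsum_eq_sum_of_fintype, Polynomial.eval_finsetSum, Nat.cast_sum]
  refine Finset.sum_congr rfl fun s _ => ?_
  have : Fintype (Quotient s.1) := Fintype.ofFinite _
  rw [descPochhammer_eval_eq_descFactorial, Nat.card_eq_fintype_card,
    Nat.card_eq_fintype_card, Fintype.card_embedding_eq, Fintype.card_fin]

/-! ### Planar triangulations -/

/-- A rotation system on a graph: a cyclic order of the darts (oriented edges) leaving each
vertex. By the Heffter–Edmonds principle, rotation systems on a connected finite graph are the
same as its cellular embeddings in closed oriented surfaces, up to homeomorphism. -/
structure RotationSystem {V : Type*} (G : SimpleGraph V) where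
  /-- the next dart in the rotation at the initial vertex of a dart -/
  next : Equiv.Perm G.Dart
  next_fst : ∀ d, (next d).fst = d.fst
  sameCycle : ∀ d e : G.Dart, d.fst = e.fst → next.SameCycle d e

namespace RotationSystem

variable {V : Type*} {G : SimpleGraph V}

/-- Face tracing: reverse the dart, then turn to the next dart at the vertex reached. -/
def facePerm (R : RotationSystem G) : Equiv.Perm G.Dart :=
  (Function.Involutive.toPerm _ SimpleGraph.Dart.symm_involutive).trans R.next

/-- The faces of the embedding are the orbits of face tracing. -/
def Face (R : RotationSystem G) : Type _ :=
  Quotient (Equiv.Perm.SameCycle.setoid R.facePerm)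

end RotationSystem

/-- `G` is the graph of a triangulation of the sphere: it is connected and has a cellular
embedding in a surface with Euler characteristic `|V| - |E| + |F| = 2` in which every face is
bounded by three darts. -/
def IsPlanarTriangulation {V : Type*} [Finite V] (G : SimpleGraph V) : Prop :=
  G.Connected ∧ ∃ R : RotationSystem G,
    Nat.card V + Nat.card R.Face = Nat.card G.edgeSet + 2 ∧
    ∀ d : G.Dart, {e : G.Dart | R.facePerm.SameCycle d e}.ncard = 3

/-! ### Gluing end-graphs to the cylindrical triangular lattice -/

/-- A graph with a distinguished 4-cycle (indices are read modulo 4). -/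
structure QuadGraph (V : Type*) where
  graph : SimpleGraph V
  corner : Fin 4 → V
  corner_injective : Function.Injective corner
  adj_corner : ∀ i, graph.Adj (corner i) (corner (i + 1))

/-- The strip `4_P × n_F` of the triangular lattice: `n` layers, each of which is a 4-cycle;
the vertex `i` of a layer is joined to the vertices `i` and `i + 1` of the following layer. -/
def triangularStrip (n : ℕ) : SimpleGraph (Fin n × Fin 4) :=
  SimpleGraph.fromRel fun p q =>
    (q.1 = p.1 ∧ q.2 = p.2 + 1) ∨
    (q.1.val = p.1.val + 1 ∧ (q.2 = p.2 ∨ q.2 = p.2 + 1))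

/-- The identifications made when `A` is glued to the top layer and `B` to the bottom layer of
the strip. -/
inductive GlueRel {V W : Type*} (A : QuadGraph V) (B : QuadGraph W) (n : ℕ) (hn : 0 < n) :
    V ⊕ (Fin n × Fin 4) ⊕ W → V ⊕ (Fin n × Fin 4) ⊕ W → Prop
  | top (i : Fin 4) :
      GlueRel A B n hn (.inl (A.corner i)) (.inr (.inl (⟨0, hn⟩, i)))
  | bottom (i : Fin 4) :
      GlueRel A B n hn (.inr (.inl (⟨n - 1, Nat.sub_lt hn Nat.one_pos⟩, i)))
        (.inr (.inr (B.corner i)))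

/-- The vertices of `X_{A,B}(n)`. -/
abbrev DoubleEndedVertex {V W : Type*} (A : QuadGraph V) (B : QuadGraph W) (n : ℕ)
    (hn : 0 < n) : Type _ :=
  Quot (GlueRel A B n hn)

/-- The graph `X_{A,B}(n)`, obtained from the strip `4_P × n_F` by gluing `A` to the 4-cycle at
the top and `B` to the 4-cycle at the bottom. -/
def doubleEnded {V W : Type*} (A : QuadGraph V) (B : QuadGraph W) (n : ℕ) (hn : 0 < n) :
    SimpleGraph (DoubleEndedVertex A B n hn) :=
  (A.graph ⊕g (triangularStrip n ⊕g B.graph)).map (Quot.mk (GlueRel A B n hn))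

/-! ### The end-graphs -/

/-- The 4-wheel `C₄ + K₁` with hub `4` and rim `0, 1, 2, 3`; the rim is distinguished. -/
def wheelFour : QuadGraph (Fin 5) where
  graph := SimpleGraph.fromRel fun u v =>
    (u, v) ∈ ([(0, 1), (1, 2), (2, 3), (3, 0), (4, 0), (4, 1), (4, 2), (4, 3)] :
      List (Fin 5 × Fin 5))
  corner := ![0, 1, 2, 3]
  corner_injective := by decide
  adj_corner := by simp only [SimpleGraph.fromRel_adj]; decide

/-- The 16-vertex triangulation `H` of a square; the outer square `0, 1, 2, 3` is
distinguished. -/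
def graphH : QuadGraph (Fin 16) where
  graph := SimpleGraph.fromRel fun u v =>
    (u, v) ∈ ([
      (0, 1), (1, 2), (2, 3), (3, 0),
      (0, 8), (8, 1), (1, 9), (9, 2), (2, 10), (10, 3), (3, 11), (11, 0),
      (0, 4), (1, 5), (2, 6), (3, 7),
      (4, 8), (8, 5), (5, 9), (9, 6), (6, 10), (10, 7), (7, 11), (11, 4),
      (8, 12), (9, 13), (10, 14), (11, 15),
      (4, 12), (12, 5), (5, 13), (13, 6), (6, 14), (14, 7), (7, 15), (15, 4),
      (12, 13), (13, 14), (14, 15), (15, 12), (12, 14)] : List (Fin 16 × Fin 16))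
  corner := ![0, 1, 2, 3]
  corner_injective := by decide
  adj_corner := by simp only [SimpleGraph.fromRel_adj]; decide

/-! The proof is a transfer-matrix computation followed by a perturbation argument at q = 4.
Extending a colouring of one 4-cycle of the strip to what lies below depends only on which colours
coincide. Proper colourings of a 4-cycle have four equality patterns: four colours, three in two
ways, or two. The kernel computation shows that the two three-colour patterns always get the same
count. So three numbers describe the part below a layer, and one more layer multiplies this vector
by a 3×3 matrix with entries in ℤ[q] (`sum_compatible`, `stateVec`). Pairing with the extension
counts of `graphH` gives the number of q-colourings for every natural q, hence the chromatic
polynomial (`chromaticPolynomial_doubleEnded`).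

Planarity leaves only two dimensions: the four-colour and the two-colour value add up to twice the
three-colour value (`stateVec_planar`). Put q = 4 - x. On the pairs (four-colour value, two-colour
value) the matrix is 2·I + x·[[-8, -1], [0, -5]] + O(x²), so the eigenvalues are l = 2 - 5x + O(x²)
and μ = 2 - 8x + O(x²), and the eigenvector of the larger one tends to the direction (-1, 3). At x =
0, `graphH` contributes the covector (648, 216), which annihilates (-1, 3). This is why the value at
4 is positive (`totalValue_four_pos`) although the amplitude of l ^ n vanishes there: the whole
value 432 · 2 ^ n comes from the other eigenvalue. For small x > 0 the amplitude of l ^ n is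
negative of order x, while that of μ ^ n stays near 432. As μ < l, the negative term wins for large
n (`exists_totalValue_neg`), and the intermediate value theorem gives the root.

The counts come from colouring vertices one at a time and remembering only the pattern of colours on
a small frontier (`colorSum_eq_patternSum`). Pushing patterns with polynomial weights forward
(`integral_run`) makes this a finite computation in the kernel.

For the triangulation, an explicit cyclic list of neighbours is given at each vertex in layered
coordinates. A local condition on consecutive neighbours makes all faces triangles, and Euler's
formula becomes a degree count (`isPlanarTriangulation_of_lists`). -/

namespace ColorCount

/-! ### Summing over colourings one vertex at a time -/

/-- One step of a colouring procedure: colour `vertex`, avoiding the colours of `nbrs`, then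
retain in the frontier only the vertices selected by `keep`. -/
structure Step (V : Type*) where
  vertex : V
  nbrs : List V
  keep : List Bool

/-- Colour the vertices of a procedure one after the other in all possible ways and sum `Φ` over
the resulting colourings. -/
def colorSum {V C : Type*} [DecidableEq V] [DecidableEq C] [Fintype C] (Φ : (V → C) → ℤ) :
    List (Step V) → (V → C) → ℤ
  | [], c => Φ c
  | t :: p, c => ∑ x : C, if ∀ u ∈ t.nbrs, c u ≠ x then
      colorSum Φ p (Function.update c t.vertex x) else 0

/-- The condition imposed on a colouring by a procedure. -/
def Obeys {V C : Type*} (p : List (Step V)) (f : V → C) : Prop :=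
  ∀ t ∈ p, ∀ u ∈ t.nbrs, f u ≠ f t.vertex

/-- Each vertex is coloured only once, after its listed neighbours. -/
def Ordered {V : Type*} : List (Step V) → Prop
  | [] => True
  | t :: p => (t.vertex ∉ p.map Step.vertex) ∧
      (∀ u ∈ t.nbrs, u ∉ (t :: p).map Step.vertex) ∧ Ordered p

instance Ordered.decidable {V : Type*} [DecidableEq V] : (p : List (Step V)) → Decidable (Ordered p)
  | [] => inferInstanceAs (Decidable True)
  | t :: p => by
    have := Ordered.decidable p
    exact inferInstanceAs (Decidable (_ ∧ _ ∧ _))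

/-- `Ordered` makes every constraint refer to colours already fixed and never changed later, so the
global sum factors into nested sums over single colours. -/
theorem sum_obeys_eq_colorSum {V C : Type*} [Fintype V] [DecidableEq V] [DecidableEq C]
    [Fintype C] (Φ : (V → C) → ℤ) (p : List (Step V)) (hp : Ordered p) (c : V → C) :
    open Classical in
    (∑ f : V → C, if (∀ u, u ∉ p.map Step.vertex → f u = c u) ∧ Obeys p f then Φ f else 0) =
      colorSum Φ p c := by
  classical
  induction p generalizing c with
  | nil =>
    rw [Finset.sum_eq_single c]
    · simp [colorSum, Obeys]
    · intro f _ hf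
      rw [if_neg]
      rintro ⟨h, -⟩
      exact hf (funext fun u => h u (by simp))
    · simp
  | cons t p ih =>
    obtain ⟨h1, h2, h3⟩ := hp
    simp only [colorSum]
    simp only [← ih h3]
    have key : ∀ f : V → C,
        (if (∀ u, u ∉ (t :: p).map Step.vertex → f u = c u) ∧ Obeys (t :: p) f then Φ f else 0)
        = ∑ x : C, if ∀ u ∈ t.nbrs, c u ≠ x then
          (if (∀ u, u ∉ p.map Step.vertex → f u = Function.update c t.vertex x u) ∧ Obeys p f
            then Φ f else 0) else 0 := by
      intro f
      -- Each `f` is counted once, for the colour that it gives to the new vertex.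
      rw [Finset.sum_eq_single (f t.vertex)]
      · have e : (∀ u, u ∉ p.map Step.vertex →
            f u = Function.update c t.vertex (f t.vertex) u) ↔
            (∀ u, u ∉ (t :: p).map Step.vertex → f u = c u) := by
          constructor
          · intro h u hu
            simp only [List.map_cons, List.mem_cons, not_or] at hu
            rw [h u hu.2, Function.update_of_ne hu.1]
          · intro h u hu
            by_cases hut : u = t.vertex
            · subst hut; simp
            · rw [Function.update_of_ne hut]
              exact h u (by simp only [List.map_cons, List.mem_cons, not_or]; exact ⟨hut, hu⟩)
        simp only [e]
        by_cases ha : ∀ u, u ∉ (t :: p).map Step.vertex → f u = c u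
        · have e2 : (∀ u ∈ t.nbrs, c u ≠ f t.vertex) ↔ ∀ u ∈ t.nbrs, f u ≠ f t.vertex := by
            refine forall₂_congr fun u hu => ?_
            rw [ha u (h2 u hu)]
          have e3 : Obeys (t :: p) f ↔ (∀ u ∈ t.nbrs, f u ≠ f t.vertex) ∧ Obeys p f := by
            simp [Obeys]
          simp only [e2, e3]
          split_ifs <;> tauto
        · split_ifs <;> tauto
      · intro x _ hx
        have : ¬ (∀ u, u ∉ p.map Step.vertex → f u = Function.update c t.vertex x u) := by
          intro h
          have := h t.vertex h1
          simp only [Function.update_self] at this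
          exact hx this.symm
        split_ifs <;> tauto
      · simp
    rw [Finset.sum_congr rfl fun f _ => key f, Finset.sum_comm]
    refine Finset.sum_congr rfl fun x _ => ?_
    split_ifs with hx
    · rfl
    · simp

/-! ### Equality patterns of the colours on a frontier -/

/-- The entries of a list selected by a mask. -/
def select {α : Type*} : List Bool → List α → List α
  | true :: m, x :: l => x :: select m l
  | false :: m, _ :: l => select m l
  | _, _ => []

theorem map_select {α β : Type*} (f : α → β) (m : List Bool) (l : List α) :
    (select m l).map f = select m (l.map f) := by
  induction m generalizing l with
  | nil => simp [select]
  | cons b m ih => cases l <;> cases b <;> simp [select, ih]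

theorem mem_of_mem_select {α : Type*} {m : List Bool} {l : List α} {x : α}
    (h : x ∈ select m l) : x ∈ l := by
  induction m generalizing l with
  | nil => simp [select] at h
  | cons b m ih =>
    cases l <;> cases b <;> simp only [select, List.not_mem_nil, List.mem_cons] at h ⊢
    · exact Or.inr (ih h)
    · exact h.imp_right ih

/-! The functions below are meant for evaluation in the kernel, and are therefore defined by
recursors. -/

/-- Boolean membership in a list. -/
noncomputable def memb (x : ℕ) (l : List ℕ) : Bool :=
  List.rec (motive := fun _ => Bool) false (fun a _ ih => bif Nat.beq a x then true else ih) l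

theorem memb_iff {x : ℕ} {l : List ℕ} : memb x l = true ↔ x ∈ l := by
  induction l with
  | nil => simp [memb]
  | cons a l ih =>
    change (bif Nat.beq a x then true else memb x l) = true ↔ _
    cases h : Nat.beq a x with
    | true => simp [Nat.eq_of_beq_eq_true h]
    | false =>
      have : x ≠ a := fun e => Nat.ne_of_beq_eq_false h e.symm
      simp [ih, this]

/-- The distinct entries of a list. -/
noncomputable def distinct (l : List ℕ) : List ℕ :=
  List.rec (motive := fun _ => List ℕ) [] (fun a _ ih => bif memb a ih then ih else a :: ih) l

theorem distinct_cons (a : ℕ) (l : List ℕ) :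
    distinct (a :: l) = bif memb a (distinct l) then distinct l else a :: distinct l := rfl

theorem mem_distinct {x : ℕ} {l : List ℕ} : x ∈ distinct l ↔ x ∈ l := by
  induction l with
  | nil => simp [distinct]
  | cons a l ih =>
    rw [distinct_cons]
    cases h : memb a (distinct l) with
    | true =>
      rw [memb_iff] at h
      simp only [cond_true, ih, List.mem_cons]
      refine ⟨Or.inr, ?_⟩
      rintro (rfl | h')
      · exact ih.1 h
      · exact h'
    | false => simp [ih]

theorem nodup_distinct (l : List ℕ) : (distinct l).Nodup := by
  induction l with
  | nil => simp [distinct]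
  | cons a l ih =>
    rw [distinct_cons]
    cases h : memb a (distinct l) with
    | true => exact ih
    | false =>
      rw [← Bool.not_eq_true, memb_iff] at h
      exact List.nodup_cons.2 ⟨h, ih⟩

/-- The position of an entry of a list. -/
noncomputable def pos (x : ℕ) (l : List ℕ) : ℕ :=
  List.rec (motive := fun _ => ℕ) 0 (fun a _ ih => bif Nat.beq a x then 0 else Nat.succ ih) l

theorem pos_eq_idxOf (x : ℕ) (l : List ℕ) : pos x l = l.idxOf x := by
  induction l with
  | nil => rfl
  | cons a l ih =>
    change (bif Nat.beq a x then 0 else Nat.succ (pos x l)) = _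
    rw [ih, List.idxOf_cons]
    cases h : Nat.beq a x with
    | true => simp [Nat.eq_of_beq_eq_true h]
    | false =>
      rw [beq_false_of_ne (Nat.ne_of_beq_eq_false h)]

/-- The canonical relabelling of a pattern of blocks, with its number of blocks. -/
noncomputable def canon (s : List ℕ) : ℕ × List ℕ :=
  ((distinct s).length,
    List.rec (motive := fun _ => List ℕ) [] (fun a _ ih => pos a (distinct s) :: ih) s)

theorem canon_eq (s : List ℕ) :
    canon s = ((distinct s).length, s.map fun x => (distinct s).idxOf x) := by
  have : ∀ d l : List ℕ,
      List.rec (motive := fun _ => List ℕ) [] (fun a _ ih => pos a d :: ih) l =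
        l.map fun x => d.idxOf x := by
    intro d l
    induction l with
    | nil => rfl
    | cons a l ih => exact congrArg₂ List.cons (pos_eq_idxOf a d) ih
  rw [canon, this]

/-- The sum of `φ` over all extensions of a pattern of `n` blocks by the steps of a procedure,
when there are `q` colours. -/
noncomputable def patternSum {V : Type*} [DecidableEq V] (q : ℤ) (φ : List ℕ → ℤ) :
    List (Step V) → List V → ℕ → List ℕ → ℤ
  | [], _, _, s => φ s
  | t :: p, F, n, s =>
    let next (b : ℕ) : ℤ := patternSum q φ p (select t.keep (t.vertex :: F))
      (canon (select t.keep (b :: s))).1 (canon (select t.keep (b :: s))).2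
    (∑ b ∈ Finset.range n, if b ∈ select (F.map fun u => decide (u ∈ t.nbrs)) s then 0 else next b)
      + (q - n) * next n

/-- The frontier always contains the neighbours of the vertex to be coloured, and not yet the
vertex itself. -/
def FrontierOK {V : Type*} : List (Step V) → List V → Prop
  | [], _ => True
  | t :: p, F => t.vertex ∉ F ∧ (∀ u ∈ t.nbrs, u ∈ F) ∧
      FrontierOK p (select t.keep (t.vertex :: F))

instance FrontierOK.decidable {V : Type*} [DecidableEq V] : (p : List (Step V)) → (F : List V) →
    Decidable (FrontierOK p F)
  | [], _ => inferInstanceAs (Decidable True)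
  | t :: p, F => by
    have := FrontierOK.decidable p (select t.keep (t.vertex :: F))
    exact inferInstanceAs (Decidable (_ ∧ _ ∧ _))

/-- The frontier after a procedure. -/
def finalFrontier {V : Type*} : List (Step V) → List V → List V
  | [], F => F
  | t :: p, F => finalFrontier p (select t.keep (t.vertex :: F))

/-- The pattern `s` with `n` blocks describes the colour list `l`. -/
def Describes {C : Type*} (n : ℕ) (s : List ℕ) (l : List C) : Prop :=
  ∃ g : ℕ → C, Set.InjOn g (Set.Iio n) ∧ (∀ b ∈ s, b < n) ∧ l = s.map g

theorem Describes.canon {C : Type*} {n : ℕ} {s : List ℕ} {l : List C} (h : Describes n s l) :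
    Describes (canon s).1 (canon s).2 l := by
  obtain ⟨g, hg, hs, rfl⟩ := h
  rw [canon_eq]
  -- The default 0 is never used at the labels that matter: they are below the length of `distinct
  -- s`.
  refine ⟨fun i => g ((distinct s).getD i 0), ?_, ?_, ?_⟩
  · intro i hi j hj hij
    simp only [Set.mem_Iio] at hi hj
    have e : (distinct s).getD i 0 = (distinct s).getD j 0 := by
      apply hg _ _ hij
      · simp only [List.getD_eq_getElem _ _ hi]
        exact hs _ (mem_distinct.1 (List.getElem_mem hi))
      · simp only [List.getD_eq_getElem _ _ hj]
        exact hs _ (mem_distinct.1 (List.getElem_mem hj))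
    rw [List.getD_eq_getElem _ _ hi, List.getD_eq_getElem _ _ hj] at e
    exact (List.Nodup.getElem_inj_iff (nodup_distinct s)).1 e
  · intro b hb
    simp only [List.mem_map] at hb ⊢
    obtain ⟨x, hx, rfl⟩ := hb
    exact List.idxOf_lt_length_iff.2 (mem_distinct.2 hx)
  · simp only [List.map_map]
    refine List.map_congr_left fun x hx => ?_
    have : (distinct s).idxOf x < (distinct s).length :=
      List.idxOf_lt_length_iff.2 (mem_distinct.2 hx)
    simp only [Function.comp_apply, List.getD_eq_getElem _ _ this, List.getElem_idxOf]

theorem Describes.select {C : Type*} {n : ℕ} {s : List ℕ} {l : List C} (h : Describes n s l)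
    (m : List Bool) : Describes n (select m s) (select m l) := by
  obtain ⟨g, hg, hs, rfl⟩ := h
  exact ⟨g, hg, fun b hb => hs b (mem_of_mem_select hb), (map_select g m s).symm⟩

theorem mem_select_decide {V : Type*} (F : List V) (P : V → Prop) [DecidablePred P] (u : V) :
    u ∈ select (F.map fun u => decide (P u)) F ↔ u ∈ F ∧ P u := by
  induction F with
  | nil => simp [select]
  | cons a F ih =>
    by_cases h : P a
    · simp only [List.map_cons, h, decide_true, ColorCount.select, List.mem_cons, ih]
      constructor
      · rintro (rfl | h')
        · exact ⟨Or.inl rfl, h⟩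
        · exact ⟨Or.inr h'.1, h'.2⟩
      · rintro ⟨rfl | h', h''⟩
        · exact Or.inl rfl
        · exact Or.inr ⟨h', h''⟩
    · simp only [List.map_cons, h, decide_false, ColorCount.select, List.mem_cons, ih]
      constructor
      · rintro h'
        exact ⟨Or.inr h'.1, h'.2⟩
      · rintro ⟨rfl | h', h''⟩
        · exact absurd h'' h
        · exact ⟨h', h''⟩

/-- Later steps see a colouring only through the frontier, and permuting the colours changes no
count. So the colours may be replaced by block numbers, and the set of colours enters only through
its size. -/
theorem colorSum_eq_patternSum {V C : Type*} [DecidableEq V] [DecidableEq C] [Fintype C]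
    (Φ : (V → C) → ℤ) (φ : List ℕ → ℤ) (p : List (Step V)) (F : List V) (hF : FrontierOK p F)
    (hΦ : ∀ c n s, Describes n s ((finalFrontier p F).map c) → Φ c = φ s)
    (c : V → C) (n : ℕ) (s : List ℕ) (h : Describes n s (F.map c)) :
    colorSum Φ p c = patternSum (Fintype.card C) φ p F n s := by
  induction p generalizing F c n s with
  | nil => exact hΦ c n s h
  | cons t p ih =>
    obtain ⟨h1, h2, h3⟩ := hF
    have step : ∀ (x : C) (b m : ℕ), Describes m (b :: s) (x :: F.map c) →
        colorSum Φ p (Function.update c t.vertex x) =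
          patternSum (Fintype.card C) φ p (select t.keep (t.vertex :: F))
          (canon (select t.keep (b :: s))).1 (canon (select t.keep (b :: s))).2 := by
      intro x b m hd
      refine ih _ h3 hΦ _ _ _ ?_
      have : (select t.keep (t.vertex :: F)).map (Function.update c t.vertex x) =
          select t.keep (x :: F.map c) := by
        rw [map_select, List.map_cons, Function.update_self]
        congr 2
        refine List.map_congr_left fun u hu => ?_
        rw [Function.update_of_ne]
        rintro rfl
        exact h1 hu
      rw [this]
      exact (hd.select t.keep).canon
    obtain ⟨g, hg, hs, hl⟩ := h
    have hblock : ∀ b < n, (∀ u ∈ t.nbrs, c u ≠ g b) ↔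
        b ∉ select (F.map fun u => decide (u ∈ t.nbrs)) s := by
      intro b hb
      have e : (select (F.map fun u => decide (u ∈ t.nbrs)) s).map g =
          (select (F.map fun u => decide (u ∈ t.nbrs)) F).map c := by
        rw [map_select, map_select, hl]
      have hmem : b ∈ select (F.map fun u => decide (u ∈ t.nbrs)) s ↔
          g b ∈ (select (F.map fun u => decide (u ∈ t.nbrs)) s).map g := by
        constructor
        · exact fun h => List.mem_map_of_mem h
        · intro h
          obtain ⟨b', hb', e'⟩ := List.mem_map.1 h
          have := hg (hs b' (mem_of_mem_select hb')) hb e'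
          exact this ▸ hb'
      rw [hmem, e, List.mem_map]
      constructor
      · rintro h ⟨u, hu, e'⟩
        exact h u ((mem_select_decide F (· ∈ t.nbrs) u).1 hu).2 e'
      · intro h u hu e'
        exact h ⟨u, (mem_select_decide F (· ∈ t.nbrs) u).2 ⟨h2 u hu, hu⟩, e'⟩
    simp only [colorSum, patternSum]
    have hcard : ((Finset.range n).image g).card = n := by
      rw [Finset.card_image_of_injOn, Finset.card_range]
      simpa [Set.Iio] using hg
    -- Colours already named by a block are treated one by one. All others give the same
    -- contribution, which produces the factor `q - n`.
    rw [← Finset.sum_add_sum_compl ((Finset.range n).image g)]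
    congr 1
    · rw [Finset.sum_image (by simpa [Set.Iio] using hg)]
      refine Finset.sum_congr rfl fun b hb => ?_
      have hb' := Finset.mem_range.1 hb
      have hbl := hblock b hb'
      by_cases hc : ∀ u ∈ t.nbrs, c u ≠ g b
      · rw [if_pos hc, if_neg (hbl.1 hc)]
        refine step _ _ n ⟨g, hg, ?_, by rw [hl]; rfl⟩
        simpa using ⟨hb', hs⟩
      · rw [if_neg hc, if_pos (by rwa [← not_not (a := b ∈ _), ← hbl])]
    · rw [Finset.sum_congr rfl (g := fun _ => patternSum (Fintype.card C) φ p
          (select t.keep (t.vertex :: F))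
          (canon (select t.keep (n :: s))).1 (canon (select t.keep (n :: s))).2),
        Finset.sum_const, Finset.card_compl, hcard, nsmul_eq_mul, Nat.cast_sub]
      · calc n = _ := hcard.symm
          _ ≤ _ := Finset.card_le_univ _
      · intro x hx
        have hx' : ∀ b < n, g b ≠ x := by simpa using hx
        rw [if_pos]
        -- A fresh colour becomes block number `n`.
        · refine step x n (n + 1) ⟨Function.update g n x, ?_, ?_, ?_⟩
          · intro i hi j hj hij
            simp only [Set.mem_Iio] at hi hj
            rcases Nat.lt_succ_iff_lt_or_eq.1 hi with hi' | rfl <;>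
              rcases Nat.lt_succ_iff_lt_or_eq.1 hj with hj' | rfl
            · rw [Function.update_of_ne hi'.ne, Function.update_of_ne hj'.ne] at hij
              exact hg hi' hj' hij
            · rw [Function.update_of_ne hi'.ne, Function.update_self] at hij
              exact absurd hij (hx' _ hi')
            · rw [Function.update_of_ne hj'.ne, Function.update_self] at hij
              exact absurd hij.symm (hx' _ hj')
            · rfl
          · intro b hb
            rcases List.mem_cons.1 hb with rfl | hb
            · exact Nat.lt_succ_self _
            · exact Nat.lt_succ_of_lt (hs b hb)
          · rw [List.map_cons, Function.update_self, hl]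
            congr 1
            refine List.map_congr_left fun b hb => ?_
            rw [Function.update_of_ne (hs b hb).ne]
        · intro u hu e
          have : c u ∈ s.map g := hl ▸ List.mem_map_of_mem (h2 u hu)
          obtain ⟨b, hb, e'⟩ := List.mem_map.1 this
          exact hx' b (hs b hb) (e'.trans e)

/-! ### Pushing polynomial-weighted patterns through a procedure -/

/-! A distribution is a list of patterns with integer polynomials as weights. -/

/-- The value of a polynomial given by its coefficients. -/
def polyEval {R : Type*} [CommRing R] (q : R) : List ℤ → R
  | [] => 0
  | a :: l => a + q * polyEval q l

/-- Addition of coefficient lists. -/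
def polyAdd : List ℤ → List ℤ → List ℤ
  | [], l => l
  | a :: l, [] => a :: l
  | a :: l, b :: m => (a + b) :: polyAdd l m

/-- Multiplication of a coefficient list by `X - n`, where `r` is added to the constant term. -/
def polyMulSub (n : ℤ) : ℤ → List ℤ → List ℤ
  | r, [] => [r]
  | r, a :: l => (r - n * a) :: polyMulSub n a l

theorem polyEval_polyAdd {R : Type*} [CommRing R] (q : R) (l m : List ℤ) :
    polyEval q (polyAdd l m) = polyEval q l + polyEval q m := by
  induction l generalizing m with
  | nil => simp [polyAdd, polyEval]
  | cons a l ih => cases m <;> simp only [polyAdd, polyEval, ih] <;> push_cast <;> ring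

theorem polyEval_polyMulSub {R : Type*} [CommRing R] (q : R) (n r : ℤ) (l : List ℤ) :
    polyEval q (polyMulSub n r l) = r + (q - n) * polyEval q l := by
  induction l generalizing r with
  | nil => simp [polyMulSub, polyEval]
  | cons a l ih => simp only [polyMulSub, polyEval, ih]; push_cast; ring

/-- Equality of patterns. -/
noncomputable def eqPattern (l m : List ℕ) : Bool :=
  List.rec (motive := fun _ => List ℕ → Bool)
    (fun m => List.rec (motive := fun _ => Bool) true (fun _ _ _ => false) m)
    (fun a _ ih m => List.rec (motive := fun _ => Bool) false
      (fun b m _ => bif Nat.beq a b then ih m else false) m) l m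

theorem eq_of_eqPattern {l m : List ℕ} (h : eqPattern l m = true) : l = m := by
  induction l generalizing m with
  | nil =>
    cases m with
    | nil => rfl
    | cons b m => exact absurd h Bool.false_ne_true
  | cons a l ih =>
    cases m with
    | nil => exact absurd h Bool.false_ne_true
    | cons b m =>
      change (bif Nat.beq a b then eqPattern l m else false) = true at h
      cases hab : Nat.beq a b with
      | true =>
        rw [hab] at h
        rw [Nat.eq_of_beq_eq_true hab, ih h]
      | false =>
        rw [hab] at h
        exact absurd h Bool.false_ne_true

/-- Apply a function after evaluating its argument. -/
def evalNat {α : Sort*} (k : ℕ → α) : ℕ → α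
  | 0 => k 0
  | 1 => k 1
  | 2 => k 2
  | 3 => k 3
  | 4 => k 4
  | 5 => k 5
  | 6 => k 6
  | 7 => k 7
  | n => k n

theorem evalNat_eq {α : Sort*} (k : ℕ → α) (n : ℕ) : evalNat k n = k n := by
  unfold evalNat
  split <;> rfl

/-- Apply a function after evaluating its argument. -/
def evalList {α : Sort*} : (List ℕ → α) → List ℕ → α
  | k, [] => k []
  | k, a :: l => evalNat (fun a => evalList (fun l => k (a :: l)) l) a

theorem evalList_eq {α : Sort*} (k : List ℕ → α) (l : List ℕ) : evalList k l = k l := by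
  induction l generalizing k with
  | nil => rfl
  | cons a l ih => rw [evalList, evalNat_eq, ih]

/-- A pattern, its number of blocks, and its weight. -/
abbrev Entry := (ℕ × List ℕ) × List ℤ

/-- Search trees of entries. -/
inductive Tree
  | nil
  | node (l : Tree) (c : ℕ) (e : Entry) (r : Tree)

/-- The search key of a pattern. -/
noncomputable def key (l : List ℕ) : ℕ :=
  List.rec (motive := fun _ => ℕ) 0 (fun a _ ih => Nat.add a (Nat.mul 16 ih)) l

/-- Add an entry to a search tree. -/
noncomputable def Tree.insert (c : ℕ) (k : ℕ × List ℕ) (w : List ℤ) (D : Tree) : Tree :=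
  Tree.rec (motive := fun _ => Tree) (.node .nil c (k, w) .nil)
    (fun l c' e r ihl ihr => bif Nat.blt c c' then .node ihl c' e r
      else bif Nat.blt c' c then .node l c' e ihr
      else bif Nat.beq k.1 e.1.1 && eqPattern k.2 e.1.2 then .node l c' (e.1, polyAdd w e.2) r
      else .node l c' e ihr) D

/-- The integral of a function of patterns over a distribution. -/
def integral (q : ℤ) (ψ : ℕ → List ℕ → ℤ) (D : List Entry) : ℤ :=
  (D.map fun e => polyEval q e.2 * ψ e.1.1 e.1.2).sum

/-- The integral of a function of patterns over a search tree. -/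
def Tree.integral (q : ℤ) (ψ : ℕ → List ℕ → ℤ) : Tree → ℤ
  | .nil => 0
  | .node l _ e r => l.integral q ψ + polyEval q e.2 * ψ e.1.1 e.1.2 + r.integral q ψ

/-- No search-tree invariant is needed: the integral does not depend on where an entry lands. The
ordering only serves to find equal patterns so that their weights merge, and equality is tested on
the pattern itself, so coinciding keys do no harm. -/
theorem Tree.integral_insert (q : ℤ) (ψ : ℕ → List ℕ → ℤ) (c : ℕ) (k : ℕ × List ℕ) (w : List ℤ)
    (D : Tree) :
    (D.insert c k w).integral q ψ = polyEval q w * ψ k.1 k.2 + D.integral q ψ := by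
  induction D with
  | nil => simp [Tree.insert, Tree.integral]
  | node l c' e r ihl ihr =>
    change Tree.integral q ψ (bif Nat.blt c c' then .node (l.insert c k w) c' e r
      else bif Nat.blt c' c then .node l c' e (r.insert c k w)
      else bif Nat.beq k.1 e.1.1 && eqPattern k.2 e.1.2 then .node l c' (e.1, polyAdd w e.2) r
      else .node l c' e (r.insert c k w)) = _
    cases Nat.blt c c' <;> cases Nat.blt c' c <;>
      cases h : (Nat.beq k.1 e.1.1 && eqPattern k.2 e.1.2) <;>
      simp only [cond_true, cond_false, Tree.integral, ihl, ihr]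
    case false.false.true =>
      rw [Bool.and_eq_true] at h
      rw [polyEval_polyAdd, Nat.eq_of_beq_eq_true h.1, eq_of_eqPattern h.2]
      ring
    all_goals ring

/-- The list of entries of a tree, followed by a given list. -/
noncomputable def Tree.toList (D : Tree) : List Entry → List Entry :=
  Tree.rec (motive := fun _ => List Entry → List Entry) (fun L => L)
    (fun _ _ e _ ihl ihr L => ihl (e :: ihr L)) D

theorem integral_toList (q : ℤ) (ψ : ℕ → List ℕ → ℤ) (D : Tree) (L : List Entry) :
    integral q ψ (D.toList L) = D.integral q ψ + integral q ψ L := by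
  induction D generalizing L with
  | nil => simp [Tree.toList, Tree.integral]
  | node l c e r ihl ihr =>
    change integral q ψ (l.toList (e :: r.toList L)) = _
    have : integral q ψ (e :: r.toList L) = polyEval q e.2 * ψ e.1.1 e.1.2 +
        integral q ψ (r.toList L) := rfl
    rw [ihl, this, ihr, Tree.integral]
    ring

/-- Add an entry to a search tree, evaluating its pattern. -/
noncomputable def insertEval (k : ℕ × List ℕ) (w : List ℤ) (D : Tree) : Tree :=
  evalNat (fun n => evalList (fun s => D.insert (key s) (n, s) w) k.2) k.1

theorem integral_insertEval (q : ℤ) (ψ : ℕ → List ℕ → ℤ) (k : ℕ × List ℕ) (w : List ℤ)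
    (D : Tree) :
    (insertEval k w D).integral q ψ = polyEval q w * ψ k.1 k.2 + D.integral q ψ := by
  rw [insertEval, evalNat_eq, evalList_eq, Tree.integral_insert]

/-- Distribute a single pattern over its continuations by a vertex in one of the blocks
`0, …, n - 1`, where `m` lists the forbidden blocks. -/
noncomputable def spreadOld (keep : List Bool) (m s : List ℕ) (w : List ℤ) (n : ℕ) :
    Tree → Tree :=
  Nat.rec (motive := fun _ => Tree → Tree) (fun D => D)
    (fun b ih D => ih
      (bif memb b m then D else insertEval (canon (select keep (b :: s))) w D)) n

theorem integral_spreadOld (q : ℤ) (ψ : ℕ → List ℕ → ℤ) (keep : List Bool) (m s : List ℕ)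
    (w : List ℤ) (n : ℕ) (D : Tree) :
    (spreadOld keep m s w n D).integral q ψ =
      polyEval q w * (∑ b ∈ Finset.range n, if b ∈ m then 0 else
        ψ (canon (select keep (b :: s))).1 (canon (select keep (b :: s))).2) +
      D.integral q ψ := by
  induction n generalizing D with
  | zero => simp [spreadOld]
  | succ n ih =>
    change (spreadOld keep m s w n
      (bif memb n m then D else insertEval (canon (select keep (n :: s))) w D)).integral q ψ = _
    rw [ih, Finset.sum_range_succ]
    by_cases h : n ∈ m
    · rw [memb_iff.2 h]
      simp [h]
    · have : memb n m = false := by rwa [← Bool.not_eq_true, memb_iff]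
      rw [this, if_neg h]
      simp only [cond_false, integral_insertEval]
      ring

/-- Distribute all patterns over their continuations by one vertex. -/
noncomputable def spread (mask keep : List Bool) (E : List Entry) : Tree → Tree :=
  List.rec (motive := fun _ => Tree → Tree) (fun D => D)
    (fun e _ ih D => ih (spreadOld keep (select mask e.1.2) e.1.2 e.2 e.1.1
      (insertEval (canon (select keep (e.1.1 :: e.1.2))) (polyMulSub e.1.1 0 e.2) D))) E

theorem integral_spread (q : ℤ) (ψ : ℕ → List ℕ → ℤ) (mask keep : List Bool) (E : List Entry)
    (D : Tree) :
    (spread mask keep E D).integral q ψ =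
      integral q (fun n s => (∑ b ∈ Finset.range n, if b ∈ select mask s then 0 else
        ψ (canon (select keep (b :: s))).1 (canon (select keep (b :: s))).2)
        + (q - n) * ψ (canon (select keep (n :: s))).1 (canon (select keep (n :: s))).2) E +
      D.integral q ψ := by
  induction E generalizing D with
  | nil => simp [spread, integral]
  | cons e E ih =>
    change (spread mask keep E (spreadOld keep (select mask e.1.2) e.1.2 e.2 e.1.1
      (insertEval (canon (select keep (e.1.1 :: e.1.2)))
        (polyMulSub e.1.1 0 e.2) D))).integral q ψ = _
    rw [ih, integral_spreadOld, integral_insertEval, polyEval_polyMulSub]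
    simp only [integral, List.map_cons, List.sum_cons]
    push_cast
    ring

/-- Run a procedure on a distribution. -/
noncomputable def run {V : Type*} [DecidableEq V] :
    List (Step V) → List V → List Entry → List Entry
  | [], _, D => D
  | t :: p, F, D => run p (select t.keep (t.vertex :: F))
      ((spread (F.map fun u => decide (u ∈ t.nbrs)) t.keep D .nil).toList [])

/-- Duality of the two directions of computation: `patternSum` pulls a function back through the
steps, `run` pushes the distribution forward. Only the latter merges equal patterns and keeps `q`
symbolic, which is what makes it computable. -/
theorem integral_run {V : Type*} [DecidableEq V] (q : ℤ) (φ : List ℕ → ℤ) (p : List (Step V))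
    (F : List V) (D : List Entry) :
    integral q (fun n s => patternSum q φ p F n s) D =
      integral q (fun _ s => φ s) (run p F D) := by
  induction p generalizing F D with
  | nil => rfl
  | cons t p ih =>
    rw [run, ← ih, integral_toList, integral_spread]
    simp [patternSum, integral, Tree.integral]

theorem patternSum_eq_integral {V : Type*} [DecidableEq V] (q : ℤ) (φ : List ℕ → ℤ)
    (p : List (Step V)) (F : List V) (n : ℕ) (s : List ℕ) :
    patternSum q φ p F n s = integral q (fun _ s => φ s) (run p F [((n, s), [1])]) := by
  rw [← integral_run]
  simp [integral, polyEval]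

/-! ### The procedures for the strip, the wheel and `graphH`, evaluated in the kernel -/

/-- Colour the second of two adjacent layers of the strip, the first layer being coloured. -/
def layerSteps : List (Step (Fin 4 ⊕ Fin 4)) :=
  [⟨.inr 0, [.inl 0, .inl 3], [true, true, true, true, true]⟩,
   ⟨.inr 1, [.inl 1, .inl 0, .inr 0], [true, true, false, true, true, true]⟩,
   ⟨.inr 2, [.inl 2, .inl 1, .inr 1], [true, true, true, false, true, true]⟩,
   ⟨.inr 3, [.inl 3, .inl 2, .inr 2, .inr 0], [true, true, true, true, false, false]⟩]

/-- Colour the hub of the wheel, the rim being coloured. -/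
def wheelSteps : List (Step (Fin 5)) := [⟨4, [0, 1, 2, 3], []⟩]

/-- Colour the interior of `graphH`, the outer square being coloured. -/
def interiorSteps : List (Step (Fin 16)) :=
  [⟨15, [], [true, true, true, true, true]⟩,
   ⟨11, [15, 0, 3], [true, true, true, true, true, true]⟩,
   ⟨7, [11, 15, 3], [true, true, true, true, true, true, true]⟩,
   ⟨4, [11, 15, 0], [true, true, false, true, true, true, true, true]⟩,
   ⟨8, [4, 0, 1], [true, true, true, true, false, true, true, true]⟩,
   ⟨12, [8, 4, 15], [true, true, false, true, true, true, true, true]⟩,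
   ⟨14, [12, 7, 15], [true, true, true, true, false, true, true, true]⟩,
   ⟨10, [14, 7, 2, 3], [true, true, true, true, false, true, true, false]⟩,
   ⟨5, [12, 8, 1], [true, true, true, true, false, true, true]⟩,
   ⟨9, [5, 1, 2], [true, true, true, true, true, false, true]⟩,
   ⟨6, [9, 10, 14, 2], [true, true, true, false, true, true, false]⟩,
   ⟨13, [6, 9, 5, 14, 12], []⟩]

/-- Colour a 4-cycle. -/
def cycleSteps : List (Step (Fin 4)) :=
  [⟨0, [], [true]⟩, ⟨1, [0], [true, true]⟩, ⟨2, [1], [true, true, true]⟩,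
   ⟨3, [2, 0], [true, true, true, true]⟩]

/-- A row of the transfer matrix, with coefficients of `q` in increasing degree. New vertices enter
the frontier at its head, so the resulting patterns list the new layer in the order 3, 2, 1, 0. The
two three-colour patterns have equal weights here, and start from equal rows in the next two
evaluations; this reduces four patterns to three values. -/
theorem run_layerSteps_four :
    run layerSteps [.inl 0, .inl 1, .inl 2, .inl 3] [((4, [0, 1, 2, 3]), [1])] =
      [((2, [0, 1, 0, 1]), [20, -9, 1]), ((3, [1, 0, 1, 2]), [-56, 42, -11, 1]),
       ((3, [0, 2, 1, 2]), [-56, 42, -11, 1]), ((4, [0, 1, 2, 3]), [218, -210, 79, -14, 1])] := by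
  decide +kernel

theorem run_layerSteps_three_left :
    run layerSteps [.inl 0, .inl 1, .inl 2, .inl 3] [((3, [0, 1, 0, 2]), [1])] =
      [((2, [0, 1, 0, 1]), [12, -7, 1]), ((3, [1, 0, 1, 2]), [-39, 34, -10, 1]),
       ((3, [0, 2, 1, 2]), [-39, 34, -10, 1]), ((4, [0, 1, 2, 3]), [168, -182, 75, -14, 1])] := by
  decide +kernel

theorem run_layerSteps_three_right :
    run layerSteps [.inl 0, .inl 1, .inl 2, .inl 3] [((3, [0, 1, 2, 1]), [1])] =
      [((2, [0, 1, 0, 1]), [12, -7, 1]), ((3, [1, 0, 1, 2]), [-39, 34, -10, 1]),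
       ((3, [0, 2, 1, 2]), [-39, 34, -10, 1]), ((4, [0, 1, 2, 3]), [168, -182, 75, -14, 1])] := by
  decide +kernel

theorem run_layerSteps_two :
    run layerSteps [.inl 0, .inl 1, .inl 2, .inl 3] [((2, [0, 1, 0, 1]), [1])] =
      [((2, [0, 1, 0, 1]), [6, -5, 1]), ((3, [1, 0, 1, 2]), [-24, 26, -9, 1]),
       ((3, [0, 2, 1, 2]), [-24, 26, -9, 1]), ((4, [0, 1, 2, 3]), [120, -154, 71, -14, 1])] := by
  decide +kernel

/-- Extensions of a 4-coloured outer square of `graphH`. -/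
def extFour : List ℤ :=
  [4533762, -12771292, 16945372, -14065277, 8157675, -3486770, 1125564, -275992, 50886, -6860,
    640, -37, 1]

/-- Extensions of a 3-coloured outer square of `graphH`. -/
def extThree : List ℤ :=
  [3765489, -11115806, 15360909, -13180085, 7839224, -3410225, 1113276, -274724, 50810, -6858,
    640, -37, 1]

/-- Extensions of a 2-coloured outer square of `graphH`. -/
def extTwo : List ℤ :=
  [2997216, -9460320, 13776446, -12294893, 7520773, -3333680, 1100988, -273456, 50734, -6856,
    640, -37, 1]

theorem run_interiorSteps_four :
    run interiorSteps [0, 1, 2, 3] [((4, [0, 1, 2, 3]), [1])] = [((0, []), extFour)] := by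
  decide +kernel

theorem run_interiorSteps_three_left :
    run interiorSteps [0, 1, 2, 3] [((3, [0, 1, 0, 2]), [1])] = [((0, []), extThree)] := by
  decide +kernel

theorem run_interiorSteps_three_right :
    run interiorSteps [0, 1, 2, 3] [((3, [0, 1, 2, 1]), [1])] = [((0, []), extThree)] := by
  decide +kernel

theorem run_interiorSteps_two :
    run interiorSteps [0, 1, 2, 3] [((2, [0, 1, 0, 1]), [1])] = [((0, []), extTwo)] := by
  decide +kernel

theorem run_cycleSteps :
    run cycleSteps [] [((0, []), [1])] =
      [((2, [0, 1, 0, 1]), [0, -1, 1]), ((3, [1, 0, 1, 2]), [0, 2, -3, 1]),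
       ((3, [0, 2, 1, 2]), [0, 2, -3, 1]), ((4, [0, 1, 2, 3]), [0, -6, 11, -6, 1])] := by
  decide +kernel

theorem run_wheelSteps_four :
    run wheelSteps [0, 1, 2, 3] [((4, [0, 1, 2, 3]), [1])] = [((0, []), [-4, 1])] := by
  decide +kernel

theorem run_wheelSteps_three_left :
    run wheelSteps [0, 1, 2, 3] [((3, [0, 1, 0, 2]), [1])] = [((0, []), [-3, 1])] := by
  decide +kernel

theorem run_wheelSteps_three_right :
    run wheelSteps [0, 1, 2, 3] [((3, [0, 1, 2, 1]), [1])] = [((0, []), [-3, 1])] := by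
  decide +kernel

theorem run_wheelSteps_two :
    run wheelSteps [0, 1, 2, 3] [((2, [0, 1, 0, 1]), [1])] = [((0, []), [-2, 1])] := by
  decide +kernel

/-! ### Functions of the number of colours on a 4-cycle -/

/-- The function of colourings of a 4-cycle with value `a` if the cycle has four colours, `b` if
it has three, and `d` if it has two. -/
def quadValue {C R : Type*} [DecidableEq C] (a b d : R) (c : Fin 4 → C) : R :=
  if c 0 = c 2 then if c 1 = c 3 then d else b else if c 1 = c 3 then b else a

/-- Proper colourings of a 4-cycle. -/
def ProperQuad {C : Type*} (c : Fin 4 → C) : Prop := ∀ i, c i ≠ c (i + 1)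

/-- Colourings of consecutive layers of the strip that do not conflict. -/
def Compatible {C : Type*} (c c' : Fin 4 → C) : Prop := ∀ i, c i ≠ c' i ∧ c i ≠ c' (i + 1)

theorem describes_map_getD {C : Type*} (l : List C) (x : C) (h : l.Nodup) (s : List ℕ)
    (hs : ∀ b ∈ s, b < l.length) : Describes l.length s (s.map fun i => l.getD i x) := by
  refine ⟨fun i => l.getD i x, ?_, hs, rfl⟩
  intro i hi j hj hij
  dsimp only at hij
  rw [List.getD_eq_getElem _ _ hi, List.getD_eq_getElem _ _ hj] at hij
  exact (List.Nodup.getElem_inj_iff h).1 hij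

/-- A proper colouring of a 4-cycle is decided up to renaming by the two diagonal equalities, so
four evaluations of `run` cover all cases. Agreement of the two three-colour evaluations puts the
result back in the form `quadValue`. -/
theorem colorSum_eq_quadValue {V C : Type*} [DecidableEq V] [DecidableEq C] [Fintype C]
    (Φ : (V → C) → ℤ) (φ : List ℕ → ℤ) (p : List (Step V)) (F : List V) (hF : FrontierOK p F)
    (hΦ : ∀ c n s, Describes n s ((finalFrontier p F).map c) → Φ c = φ s)
    (f : V → C) (c : Fin 4 → C) (hc : ProperQuad c) (hf : F.map f = [c 0, c 1, c 2, c 3])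
    {a b d : ℤ}
    (ha : integral (Fintype.card C) (fun _ s => φ s) (run p F [((4, [0, 1, 2, 3]), [1])]) = a)
    (hb : integral (Fintype.card C) (fun _ s => φ s) (run p F [((3, [0, 1, 0, 2]), [1])]) = b)
    (hb' : integral (Fintype.card C) (fun _ s => φ s) (run p F [((3, [0, 1, 2, 1]), [1])]) = b)
    (hd : integral (Fintype.card C) (fun _ s => φ s) (run p F [((2, [0, 1, 0, 1]), [1])]) = d) :
    colorSum Φ p f = quadValue a b d c := by
  have key := fun n s h => colorSum_eq_patternSum Φ φ p F hF hΦ f n s (hf ▸ h)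
  simp only [patternSum_eq_integral] at key
  have h0 : c 0 ≠ c 1 := hc 0
  have h1 : c 1 ≠ c 2 := hc 1
  have h2 : c 2 ≠ c 3 := hc 2
  have h3 : c 3 ≠ c 0 := hc 3
  unfold quadValue
  split_ifs with h02 h13 h13
  · rw [key 2 [0, 1, 0, 1], hd]
    rw [← h02, ← h13]
    exact describes_map_getD [c 0, c 1] (c 0) (by simpa using h0) [0, 1, 0, 1] (by simp)
  · rw [key 3 [0, 1, 0, 2], hb]
    rw [← h02]
    exact describes_map_getD [c 0, c 1, c 3] (c 0) (by simp [h0, h13, h3.symm]) [0, 1, 0, 2]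
      (by simp)
  · rw [key 3 [0, 1, 2, 1], hb']
    rw [← h13]
    exact describes_map_getD [c 0, c 1, c 2] (c 0) (by simp [h0, h02, h1]) [0, 1, 2, 1]
      (by simp)
  · rw [key 4 [0, 1, 2, 3], ha]
    exact describes_map_getD [c 0, c 1, c 2, c 3] (c 0)
      (by simp [h0, h1, h2, h3.symm, h02, h13]) [0, 1, 2, 3] (by simp)

/-- The value of `quadValue` on a reversed list of four entries. -/
def quadPattern (a b d : ℤ) (s : List ℕ) : ℤ :=
  quadValue a b d fun i : Fin 4 => s.getD (3 - i.val) 0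

/-- The list is reversed because a procedure leaves its most recently coloured vertex at the head of
the frontier. -/
theorem quadValue_eq_quadPattern {C : Type*} [DecidableEq C] (a b d : ℤ) (c : Fin 4 → C) (n : ℕ)
    (s : List ℕ) (h : Describes n s [c 3, c 2, c 1, c 0]) :
    quadValue a b d c = quadPattern a b d s := by
  obtain ⟨g, hg, hs, hl⟩ := h
  have hlen : s.length = 4 := by simpa using (congrArg List.length hl).symm
  match s, hlen with
  | [w, z, y, x], _ =>
    simp only [List.map_cons, List.map_nil, List.cons.injEq, and_true] at hl
    obtain ⟨hw, hz, hy, hx⟩ := hl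
    have e1 : c 0 = c 2 ↔ x = z := by
      rw [hx, hz]
      exact hg.eq_iff (hs _ (by simp)) (hs _ (by simp))
    have e2 : c 1 = c 3 ↔ y = w := by
      rw [hy, hw]
      exact hg.eq_iff (hs _ (by simp)) (hs _ (by simp))
    simp only [quadPattern, quadValue, e1, e2]
    simp

/-- The sum over the proper colourings of a 4-cycle of a function of the number of colours. -/
theorem sum_quadValue {C : Type*} [DecidableEq C] [Fintype C] (a b d : ℤ) :
    open Classical in
    (∑ c : Fin 4 → C, if ProperQuad c then quadValue a b d c else 0) =
      polyEval (Fintype.card C : ℤ) [0, -6, 11, -6, 1] * a +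
      2 * (polyEval (Fintype.card C : ℤ) [0, 2, -3, 1] * b) +
      polyEval (Fintype.card C : ℤ) [0, -1, 1] * d := by
  classical
  rcases isEmpty_or_nonempty C with hC | ⟨⟨x⟩⟩
  · simp [polyEval, Finset.univ_eq_empty]
  have h := sum_obeys_eq_colorSum (C := C) (quadValue a b d) cycleSteps (by decide) fun _ => x
  rw [colorSum_eq_patternSum (quadValue a b d) (quadPattern a b d) cycleSteps [] (by decide)
    (fun c n s hd => quadValue_eq_quadPattern a b d c n s hd) _ 0 []
    ⟨fun _ => x, by simp [Set.InjOn], by simp, rfl⟩,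
    patternSum_eq_integral, run_cycleSteps] at h
  have e : ∀ f : Fin 4 → C, (∀ u, u ∉ cycleSteps.map Step.vertex → f u = x) ∧
      Obeys cycleSteps f ↔ ProperQuad f := by
    intro f
    simp only [cycleSteps, Obeys, ProperQuad, Fin.forall_fin_succ]
    simp
    tauto
  simp only [e] at h
  rw [h]
  simp [integral, quadPattern, quadValue]
  ring

/-- One step of the transfer matrix of the strip. -/
def transfer {R : Type*} [CommRing R] (q : R) (v : R × R × R) : R × R × R :=
  (polyEval q [218, -210, 79, -14, 1] * v.1 + 2 * (polyEval q [-56, 42, -11, 1] * v.2.1) +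
    polyEval q [20, -9, 1] * v.2.2,
   polyEval q [168, -182, 75, -14, 1] * v.1 + 2 * (polyEval q [-39, 34, -10, 1] * v.2.1) +
    polyEval q [12, -7, 1] * v.2.2,
   polyEval q [120, -154, 71, -14, 1] * v.1 + 2 * (polyEval q [-24, 26, -9, 1] * v.2.1) +
    polyEval q [6, -5, 1] * v.2.2)

/-- Adding a layer maps functions of the form `quadValue` to functions of the same form; this is the
transfer matrix. -/
theorem sum_compatible {C : Type*} [DecidableEq C] [Fintype C] (v : ℤ × ℤ × ℤ) (c : Fin 4 → C)
    (hc : ProperQuad c) :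
    open Classical in
    (∑ c' : Fin 4 → C, if ProperQuad c' ∧ Compatible c c' then quadValue v.1 v.2.1 v.2.2 c'
      else 0) =
      quadValue (transfer (Fintype.card C : ℤ) v).1 (transfer (Fintype.card C : ℤ) v).2.1
        (transfer (Fintype.card C : ℤ) v).2.2 c := by
  classical
  obtain ⟨a, b, d⟩ := v
  have h := sum_obeys_eq_colorSum (C := C) (fun f : Fin 4 ⊕ Fin 4 → C =>
    quadValue a b d fun i => f (.inr i)) layerSteps (by decide) (Sum.elim c c)
  rw [colorSum_eq_quadValue _ (quadPattern a b d) layerSteps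
    [.inl 0, .inl 1, .inl 2, .inl 3] (by decide)
    (fun c n s hd => quadValue_eq_quadPattern a b d (fun i => c (.inr i)) n s hd) (Sum.elim c c) c hc rfl
    (by rw [run_layerSteps_four]) (by rw [run_layerSteps_three_left])
    (by rw [run_layerSteps_three_right]) (by rw [run_layerSteps_two])] at h
  -- The procedure never colours the first layer, so among pairs of layer colourings only those with
  -- first entry `c` contribute.
  rw [← (Equiv.sumArrowEquivProdArrow _ _ _).symm.sum_comp, Fintype.sum_prod_type,
    Finset.sum_eq_single c] at h
  · have e : ∀ f : Fin 4 → C, (∀ u, u ∉ layerSteps.map Step.vertex →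
        (Equiv.sumArrowEquivProdArrow _ _ _).symm (c, f) u = Sum.elim c c u) ∧
        Obeys layerSteps ((Equiv.sumArrowEquivProdArrow _ _ _).symm (c, f)) ↔
        ProperQuad f ∧ Compatible c f := by
      intro f
      simp only [layerSteps, Obeys, ProperQuad, Compatible, Fin.forall_fin_succ, Sum.forall]
      simp [Equiv.sumArrowEquivProdArrow]
      tauto
    simp only [e] at h
    refine h.trans ?_
    congr 1 <;> simp [integral, quadPattern, quadValue, transfer] <;> ring
  · intro c' _ hc'
    refine Finset.sum_eq_zero fun f _ => if_neg ?_
    rintro ⟨h, -⟩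
    refine hc' (funext fun i => ?_)
    exact h (.inl i) (by simp [layerSteps])
  · simp

/-! ### Extensions of a colouring of the distinguished 4-cycle -/

/-- Proper colourings of a graph, as functions. -/
def Proper {V C : Type*} (G : SimpleGraph V) (f : V → C) : Prop := ∀ u v, G.Adj u v → f u ≠ f v

open Classical in
/-- The number of extensions of a colouring of the distinguished 4-cycle. -/
noncomputable def extCount {V C : Type*} [Fintype V] [DecidableEq V] [Fintype C]
    [DecidableEq C] (A : QuadGraph V)
    (c : Fin 4 → C) : ℤ :=
  ∑ f : V → C, if Proper A.graph f ∧ (fun i => f (A.corner i)) = c then 1 else 0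

/-- Used with `E` the list defining an end-graph and `E'` the edges read off the rim and a
procedure. Mutual inclusion up to orientation is decidable, and certifies that the procedure misses
no edge and invents none. `hE` is needed because `SimpleGraph.fromRel` discards loops. -/
theorem proper_fromRel_iff {V C : Type*} (E E' : List (V × V)) (hE : ∀ e ∈ E, e.1 ≠ e.2)
    (h : ∀ e ∈ E, e ∈ E' ∨ e.swap ∈ E') (h' : ∀ e ∈ E', e ∈ E ∨ e.swap ∈ E) (f : V → C) :
    Proper (SimpleGraph.fromRel fun u v => (u, v) ∈ E) f ↔ ∀ e ∈ E', f e.1 ≠ f e.2 := by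
  have key : ∀ E E' : List (V × V), (∀ e ∈ E, e ∈ E' ∨ e.swap ∈ E') →
      (∀ e ∈ E', f e.1 ≠ f e.2) → ∀ e ∈ E, f e.1 ≠ f e.2 := by
    intro E E' h hf e he
    rcases h e he with h | h
    · exact hf e h
    · exact (hf _ h).symm
  constructor
  · intro hf
    refine key E' E h' ?_
    rintro ⟨u, v⟩ he
    exact hf u v ⟨hE _ he, Or.inl he⟩
  · rintro hf u v ⟨-, he | he⟩
    · exact key E E' h hf _ he
    · exact (key E E' h hf _ he).symm

/-- The edges of a distinguished 4-cycle. -/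
def rimEdges {V : Type*} (A : QuadGraph V) : List (V × V) :=
  (List.finRange 4).map fun i => (A.corner i, A.corner (i + 1))

/-- The edges between each vertex and its neighbours listed in a procedure. -/
def stepEdges {V : Type*} (p : List (Step V)) : List (V × V) :=
  p.flatMap fun t => t.nbrs.map fun u => (u, t.vertex)

theorem forall_rimEdges_append_stepEdges {V C : Type*} (A : QuadGraph V) (p : List (Step V))
    (f : V → C) :
    (∀ e ∈ rimEdges A ++ stepEdges p, f e.1 ≠ f e.2) ↔
      ProperQuad (fun i => f (A.corner i)) ∧ Obeys p f := by
  simp only [List.mem_append, or_imp, forall_and, rimEdges, stepEdges, ProperQuad, Obeys,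
    List.mem_map, List.mem_flatMap, List.mem_finRange, true_and]
  refine and_congr ?_ ?_
  · exact ⟨fun h i => h _ ⟨i, rfl⟩, by rintro h _ ⟨i, rfl⟩; exact h i⟩
  · exact ⟨fun h t ht u hu => h _ ⟨t, ht, u, hu, rfl⟩,
      by rintro h _ ⟨t, ht, u, hu, rfl⟩; exact h t ht u hu⟩

theorem extCount_eq_quadValue {V C : Type*} [Fintype V] [DecidableEq V] [Fintype C]
    [DecidableEq C] (A : QuadGraph V) (p : List (Step V)) (F : List V)
    (hA : ∀ f : V → C, Proper A.graph f ↔ ProperQuad (fun i => f (A.corner i)) ∧ Obeys p f)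
    (hp : Ordered p) (hF : FrontierOK p F)
    (hFA : F = [A.corner 0, A.corner 1, A.corner 2, A.corner 3])
    (hcorner : ∀ u, u ∉ p.map Step.vertex ↔ ∃ i, A.corner i = u)
    (c : Fin 4 → C) {a b d : ℤ}
    (ha : integral (Fintype.card C) (fun _ _ => 1) (run p F [((4, [0, 1, 2, 3]), [1])]) = a)
    (hb : integral (Fintype.card C) (fun _ _ => 1) (run p F [((3, [0, 1, 0, 2]), [1])]) = b)
    (hb' : integral (Fintype.card C) (fun _ _ => 1) (run p F [((3, [0, 1, 2, 1]), [1])]) = b)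
    (hd : integral (Fintype.card C) (fun _ _ => 1) (run p F [((2, [0, 1, 0, 1]), [1])]) = d) :
    open Classical in
    extCount A c = if ProperQuad c then quadValue a b d c else 0 := by
  classical
  split_ifs with hc
  · have hg : ∀ i, Function.extend A.corner c (fun _ => c 0) (A.corner i) = c i :=
      fun i => A.corner_injective.extend_apply _ _ i
    have h := sum_obeys_eq_colorSum (C := C) (fun _ => 1) p hp
      (Function.extend A.corner c (fun _ => c 0))
    rw [colorSum_eq_quadValue (fun _ => 1) (fun _ => 1) p F hF (fun _ _ _ _ => rfl) _ c hc
      (by rw [hFA]; simp [hg]) ha hb hb' hd] at h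
    rw [← h, extCount]
    refine Finset.sum_congr rfl fun f _ => if_congr ?_ rfl rfl
    have e : (∀ u, u ∉ p.map Step.vertex →
        f u = Function.extend A.corner c (fun _ => c 0) u) ↔ (fun i => f (A.corner i)) = c := by
      constructor
      · intro h
        funext i
        rw [h _ ((hcorner _).2 ⟨i, rfl⟩), hg]
      · rintro h u hu
        obtain ⟨i, rfl⟩ := (hcorner u).1 hu
        rw [hg, ← h]
    rw [hA, e]
    constructor
    · rintro ⟨⟨-, h1⟩, h2⟩
      exact ⟨h2, h1⟩
    · rintro ⟨h1, h2⟩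
      exact ⟨⟨h1.symm ▸ hc, h2⟩, h1⟩
  · refine Finset.sum_eq_zero fun f _ => if_neg ?_
    rintro ⟨h1, h2⟩
    exact hc (h2 ▸ ((hA f).1 h1).1)

theorem extCount_graphH {C : Type*} [Fintype C] [DecidableEq C] (c : Fin 4 → C) :
    open Classical in
    extCount graphH c = if ProperQuad c then
      quadValue (polyEval (Fintype.card C : ℤ) extFour) (polyEval (Fintype.card C : ℤ) extThree)
        (polyEval (Fintype.card C : ℤ) extTwo) c else 0 := by
  refine extCount_eq_quadValue graphH interiorSteps [0, 1, 2, 3] (fun f => ?_) (by decide +kernel)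
    (by decide +kernel) rfl (by decide +kernel) c (by rw [run_interiorSteps_four]; simp [integral])
    (by rw [run_interiorSteps_three_left]; simp [integral])
    (by rw [run_interiorSteps_three_right]; simp [integral])
    (by rw [run_interiorSteps_two]; simp [integral])
  rw [← forall_rimEdges_append_stepEdges]
  exact proper_fromRel_iff _ _ (by decide +kernel) (by decide +kernel) (by decide +kernel) f

theorem extCount_wheelFour {C : Type*} [Fintype C] [DecidableEq C] (c : Fin 4 → C) :
    open Classical in
    extCount wheelFour c = if ProperQuad c then
      quadValue (Fintype.card C - 4 : ℤ) (Fintype.card C - 3) (Fintype.card C - 2) c else 0 := by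
  refine extCount_eq_quadValue wheelFour wheelSteps [0, 1, 2, 3] (fun f => ?_) (by decide)
    (by decide) rfl (by decide) c
    (by rw [run_wheelSteps_four]; simp [integral, polyEval]; ring)
    (by rw [run_wheelSteps_three_left]; simp [integral, polyEval]; ring)
    (by rw [run_wheelSteps_three_right]; simp [integral, polyEval]; ring)
    (by rw [run_wheelSteps_two]; simp [integral, polyEval]; ring)
  rw [← forall_rimEdges_append_stepEdges]
  exact proper_fromRel_iff _ _ (by decide) (by decide) (by decide) f

/-! ### The strip as a product of transfer matrices -/

/-- Proper colourings of the strip, layer by layer. -/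
def ProperStrip {C : Type*} {n : ℕ} (s : Fin n → Fin 4 → C) : Prop :=
  (∀ j, ProperQuad (s j)) ∧ ∀ j j' : Fin n, j'.val = j.val + 1 → Compatible (s j) (s j')

theorem proper_triangularStrip_iff {C : Type*} {n : ℕ} (f : Fin n × Fin 4 → C) :
    Proper (triangularStrip n) f ↔ ProperStrip fun j i => f (j, i) := by
  constructor
  · intro h
    refine ⟨fun j i => h _ _ ⟨?_, Or.inl (Or.inl ⟨rfl, rfl⟩)⟩, fun j j' hj i => ⟨?_, ?_⟩⟩
    · simp
    · exact h _ _ ⟨fun e => by have := congrArg (fun p => p.1.val) e; simp only at this; omega,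
        Or.inl (Or.inr ⟨hj, Or.inl rfl⟩)⟩
    · exact h _ _ ⟨fun e => by have := congrArg (fun p => p.1.val) e; simp only at this; omega,
        Or.inl (Or.inr ⟨hj, Or.inr rfl⟩)⟩
  · rintro ⟨h1, h2⟩
    have key : ∀ p q : Fin n × Fin 4, ((q.1 = p.1 ∧ q.2 = p.2 + 1) ∨
        (q.1.val = p.1.val + 1 ∧ (q.2 = p.2 ∨ q.2 = p.2 + 1))) → f p ≠ f q := by
      rintro ⟨j, i⟩ ⟨j', i'⟩ h
      dsimp only at h
      rcases h with ⟨rfl, rfl⟩ | ⟨hj, rfl | rfl⟩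
      · exact h1 _ i
      · exact (h2 j j' hj _).1
      · exact (h2 j j' hj i).2
    rintro p q ⟨-, h | h⟩
    · exact key p q h
    · exact (key q p h).symm

theorem properStrip_cons {C : Type*} {n : ℕ} (c : Fin 4 → C) (s : Fin (n + 1) → Fin 4 → C) :
    ProperStrip (Fin.cons c s : Fin (n + 2) → Fin 4 → C) ↔
      ProperQuad c ∧ Compatible c (s 0) ∧ ProperStrip s := by
  constructor
  · rintro ⟨h1, h2⟩
    refine ⟨h1 0, h2 0 1 rfl, fun j => h1 j.succ, fun j j' hj => h2 j.succ j'.succ ?_⟩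
    simp [hj]
  · rintro ⟨h1, h2, h3, h4⟩
    refine ⟨fun j => ?_, fun j j' hj => ?_⟩
    · refine Fin.cases ?_ (fun j => ?_) j
      · exact h1
      · exact h3 j
    · induction j using Fin.cases with
      | zero =>
        have : j' = Fin.succ 0 := Fin.ext (by simpa using hj)
        subst this
        exact h2
      | succ j =>
        induction j' using Fin.cases with
        | zero => simp at hj
        | succ j' => exact h4 j j' (by simpa using hj)

open Classical in
/-- The number of extensions of a colouring of the first layer to the strip with a graph glued
to its last layer. -/
noncomputable def stripCount {W C : Type*} [Fintype W] [DecidableEq W] [Fintype C]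
    [DecidableEq C] (B : QuadGraph W) (n : ℕ)
    (c : Fin 4 → C) : ℤ :=
  ∑ s : Fin (n + 1) → Fin 4 → C,
    if ProperStrip s ∧ s 0 = c then extCount B (s (Fin.last n)) else 0

theorem stripCount_zero {W C : Type*} [Fintype W] [DecidableEq W] [Fintype C]
    [DecidableEq C] (B : QuadGraph W)
    (c : Fin 4 → C) :
    open Classical in
    stripCount B 0 c = if ProperQuad c then extCount B c else 0 := by
  classical
  rw [stripCount, ← (Equiv.funUnique (Fin 1) (Fin 4 → C)).symm.sum_comp, Finset.sum_eq_single c]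
  · refine if_congr ?_ rfl rfl
    constructor
    · rintro ⟨h, -⟩
      exact h.1 0
    · intro h
      exact ⟨⟨fun j => h, fun j j' hj => by omega⟩, rfl⟩
  · intro c' _ h
    exact if_neg fun h' => h h'.2
  · simp

theorem stripCount_succ {W C : Type*} [Fintype W] [DecidableEq W] [Fintype C]
    [DecidableEq C] (B : QuadGraph W) (n : ℕ)
    (c : Fin 4 → C) :
    open Classical in
    stripCount B (n + 1) c = if ProperQuad c then
      ∑ c' : Fin 4 → C, if Compatible c c' then stripCount B n c' else 0 else 0 := by
  classical
  rw [stripCount, ← (Fin.consEquiv fun _ : Fin (n + 2) => Fin 4 → C).sum_comp,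
    Fintype.sum_prod_type, Finset.sum_eq_single c]
  · have e : ∀ s : Fin (n + 1) → Fin 4 → C,
        (if ProperStrip ((Fin.consEquiv fun _ : Fin (n + 2) => Fin 4 → C) (c, s)) ∧
          (Fin.consEquiv fun _ : Fin (n + 2) => Fin 4 → C) (c, s) 0 = c then
          extCount B ((Fin.consEquiv fun _ : Fin (n + 2) => Fin 4 → C) (c, s) (Fin.last (n + 1)))
          else 0) =
        if ProperQuad c ∧ Compatible c (s 0) ∧ ProperStrip s then extCount B (s (Fin.last n))
          else 0 :=
      fun s => if_congr ((and_iff_left rfl).trans (properStrip_cons c s)) rfl rfl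
    simp only [e, stripCount]
    split_ifs with hc
    · simp only [hc, true_and]
      have : ∀ c' : Fin 4 → C, (if Compatible c c' then ∑ s : Fin (n + 1) → Fin 4 → C,
          if ProperStrip s ∧ s 0 = c' then extCount B (s (Fin.last n)) else 0 else 0) =
          ∑ s : Fin (n + 1) → Fin 4 → C, if s 0 = c' then
            (if Compatible c (s 0) ∧ ProperStrip s then extCount B (s (Fin.last n)) else 0)
            else 0 := by
        intro c'
        split_ifs with h
        · refine Finset.sum_congr rfl fun s _ => ?_
          by_cases hs : s 0 = c'
          · subst hs; simp [h]
          · simp [hs]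
        · refine (Finset.sum_eq_zero fun s _ => ?_).symm
          by_cases hs : s 0 = c'
          · subst hs; simp [h]
          · simp [hs]
      simp only [this]
      rw [Finset.sum_comm]
      refine Finset.sum_congr rfl fun s _ => ?_
      simp
    · simp [hc]
  · intro c' _ h
    refine Finset.sum_eq_zero fun s _ => if_neg ?_
    rintro ⟨-, h'⟩
    exact h h'
  · simp

/-- The state vector of the strip that ends with a wheel. -/
def stateVec {R : Type*} [CommRing R] (q : R) : ℕ → R × R × R
  | 0 => (q - 4, q - 3, q - 2)
  | n + 1 => transfer q (stateVec q n)

theorem stripCount_wheelFour {C : Type*} [Fintype C] [DecidableEq C] (n : ℕ) (c : Fin 4 → C) :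
    open Classical in
    stripCount wheelFour n c = if ProperQuad c then
      quadValue (stateVec (Fintype.card C : ℤ) n).1 (stateVec (Fintype.card C : ℤ) n).2.1
        (stateVec (Fintype.card C : ℤ) n).2.2 c else 0 := by
  classical
  induction n generalizing c with
  | zero =>
    rw [stripCount_zero, extCount_wheelFour]
    split_ifs <;> rfl
  | succ n ih =>
    rw [stripCount_succ]
    split_ifs with hc
    · rw [stateVec, ← sum_compatible _ c hc]
      refine Finset.sum_congr rfl fun c' _ => ?_
      rw [ih]
      split_ifs <;> tauto
    · rfl

/-! ### Gluing, and the chromatic polynomial in closed form -/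

/-- The triples of colourings of the parts of `doubleEnded` that agree on the glued 4-cycles. -/
def Agree {V W C : Type*} (A : QuadGraph V) (B : QuadGraph W) (n : ℕ)
    (t : (V → C) × (Fin (n + 1) → Fin 4 → C) × (W → C)) : Prop :=
  (Proper A.graph t.1 ∧ ProperStrip t.2.1 ∧ Proper B.graph t.2.2) ∧
    (fun i => t.1 (A.corner i)) = t.2.1 0 ∧
    (fun i => t.2.2 (B.corner i)) = t.2.1 (Fin.last n)

/-- Colourings of `doubleEnded` are triples of colourings that agree. -/
def coloringDoubleEndedEquiv {V W C : Type*} (A : QuadGraph V) (B : QuadGraph W) (n : ℕ)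
    (hloop : ∀ x y, (A.graph ⊕g (triangularStrip (n + 1) ⊕g B.graph)).Adj x y →
      Quot.mk (GlueRel A B (n + 1) n.succ_pos) x ≠ Quot.mk (GlueRel A B (n + 1) n.succ_pos) y) :
    (doubleEnded A B (n + 1) n.succ_pos).Coloring C ≃
      {t : (V → C) × (Fin (n + 1) → Fin 4 → C) × (W → C) // Agree A B n t} where
  toFun f := ⟨(fun v => f (Quot.mk _ (.inl v)), fun j i => f (Quot.mk _ (.inr (.inl (j, i)))),
      fun w => f (Quot.mk _ (.inr (.inr w)))), by
    have hf : ∀ x y, (A.graph ⊕g (triangularStrip (n + 1) ⊕g B.graph)).Adj x y →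
        f (Quot.mk _ x) ≠ f (Quot.mk _ y) :=
      fun x y h => f.valid ⟨hloop x y h, x, y, h, rfl, rfl⟩
    refine ⟨⟨fun u v h => hf _ _ h, ?_, fun u v h => hf _ _ h⟩, funext fun i => ?_,
      funext fun i => ?_⟩
    · exact (proper_triangularStrip_iff fun p => f (Quot.mk _ (.inr (.inl p)))).1
        fun u v h => hf _ _ h
    · exact congrArg f (Quot.sound (GlueRel.top i))
    · exact (congrArg f (Quot.sound (GlueRel.bottom i))).symm⟩
  invFun t := SimpleGraph.Coloring.mk
    (Quot.lift (Sum.elim t.1.1 (Sum.elim (fun p => t.1.2.1 p.1 p.2) t.1.2.2)) (by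
      rintro x y (i | i)
      · exact congrFun t.2.2.1 i
      · exact (congrFun t.2.2.2 i).symm))
    (by
      rintro _ _ ⟨-, x, y, h, rfl, rfl⟩
      rcases x with x | x | x <;> rcases y with y | y | y
      · exact t.2.1.1 _ _ h
      · exact absurd h (by simp)
      · exact absurd h (by simp)
      · exact absurd h (by simp)
      · exact (proper_triangularStrip_iff fun p => t.1.2.1 p.1 p.2).2 t.2.1.2.1 _ _ h
      · exact absurd h (by simp)
      · exact absurd h (by simp)
      · exact absurd h (by simp)
      · exact t.2.1.2.2 _ _ h)
  left_inv f := by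
    ext v
    induction v using Quot.ind with
    | mk x => rcases x with x | x | x <;> rfl
  right_inv t := rfl

/-- Once the first layer is coloured, the two sides are coloured independently. The hypothesis
`hloop` ensures that no edge collapses under the identifications, where `SimpleGraph.map` would
silently drop its constraint. -/
theorem card_coloring_doubleEnded {V W C : Type*} [Fintype V] [DecidableEq V] [Fintype W]
    [DecidableEq W] [Fintype C] [DecidableEq C] (A : QuadGraph V) (B : QuadGraph W) (n : ℕ)
    (hloop : ∀ x y, (A.graph ⊕g (triangularStrip (n + 1) ⊕g B.graph)).Adj x y →
      Quot.mk (GlueRel A B (n + 1) n.succ_pos) x ≠ Quot.mk (GlueRel A B (n + 1) n.succ_pos) y) :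
    (Nat.card ((doubleEnded A B (n + 1) n.succ_pos).Coloring C) : ℤ) =
      ∑ c : Fin 4 → C, extCount A c * stripCount B n c := by
  classical
  rw [Nat.card_congr (coloringDoubleEndedEquiv A B n hloop), Nat.card_eq_fintype_card,
    Fintype.card_subtype, Finset.card_filter]
  push_cast
  rw [Fintype.sum_prod_type]
  simp only [Fintype.sum_prod_type, extCount, stripCount, Finset.sum_mul_sum]
  rw [Finset.sum_comm (s := Finset.univ (α := Fin 4 → C))]
  refine Finset.sum_congr rfl fun f _ => ?_
  rw [Finset.sum_comm (s := Finset.univ (α := Fin 4 → C))]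
  refine Finset.sum_congr rfl fun s _ => ?_
  rw [Finset.sum_eq_single (s 0)]
  · by_cases h : (Proper A.graph f ∧ (fun i => f (A.corner i)) = s 0) ∧ ProperStrip s
    · rw [if_pos h.1, if_pos ⟨h.2, rfl⟩, one_mul]
      refine Finset.sum_congr rfl fun w _ => if_congr ?_ rfl rfl
      simp only [Agree]
      tauto
    · have : ∀ w : W → C, ¬ Agree A B n (f, s, w) := by
        rintro w ⟨⟨h1, h2, -⟩, h3, -⟩
        exact h ⟨⟨h1, h3⟩, h2⟩
      simp only [this, if_false, Finset.sum_const_zero]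
      split_ifs <;> simp_all
  · intro c _ hc
    rw [if_neg (c := ProperStrip s ∧ s 0 = c) fun h => hc h.2.symm, mul_zero]
  · simp

/-- The chromatic polynomial of the double-ended strip in terms of the state vector. -/
def totalValue {R : Type*} [CommRing R] (q : R) (n : ℕ) : R :=
  polyEval q [0, -6, 11, -6, 1] * (polyEval q extFour * (stateVec q n).1) +
  2 * (polyEval q [0, 2, -3, 1] * (polyEval q extThree * (stateVec q n).2.1)) +
  polyEval q [0, -1, 1] * (polyEval q extTwo * (stateVec q n).2.2)

/-- Naturality in the ring allows the same expression to be read at a natural number, where it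
counts colourings, at `Polynomial.X`, and at a real number. -/
theorem polyEval_map {R S : Type*} [CommRing R] [CommRing S] (φ : R →+* S) (q : R) (l : List ℤ) :
    φ (polyEval q l) = polyEval (φ q) l := by
  induction l with
  | nil => simp [polyEval]
  | cons a l ih => simp [polyEval, ih]

theorem stateVec_map {R S : Type*} [CommRing R] [CommRing S] (φ : R →+* S) (q : R) (n : ℕ) :
    (φ (stateVec q n).1, φ (stateVec q n).2.1, φ (stateVec q n).2.2) = stateVec (φ q) n := by
  induction n with
  | zero => simp only [stateVec, map_sub, map_ofNat]
  | succ n ih => simp only [stateVec, transfer, map_add, map_mul, map_ofNat, polyEval_map, ← ih]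

theorem totalValue_map {R S : Type*} [CommRing R] [CommRing S] (φ : R →+* S) (q : R) (n : ℕ) :
    φ (totalValue q n) = totalValue (φ q) n := by
  simp only [totalValue, map_add, map_mul, map_ofNat, polyEval_map, ← stateVec_map]

theorem card_coloring_doubleEnded_graphH_wheelFour (n k : ℕ)
    (hloop : ∀ x y, (graphH.graph ⊕g (triangularStrip (n + 1) ⊕g wheelFour.graph)).Adj x y →
      Quot.mk (GlueRel graphH wheelFour (n + 1) n.succ_pos) x ≠
        Quot.mk (GlueRel graphH wheelFour (n + 1) n.succ_pos) y) :
    (Nat.card ((doubleEnded graphH wheelFour (n + 1) n.succ_pos).Coloring (Fin k)) : ℤ) =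
      totalValue (k : ℤ) n := by
  classical
  rw [card_coloring_doubleEnded graphH wheelFour n hloop]
  have h := sum_quadValue (C := Fin k) (polyEval (k : ℤ) extFour * (stateVec (k : ℤ) n).1)
    (polyEval (k : ℤ) extThree * (stateVec (k : ℤ) n).2.1)
    (polyEval (k : ℤ) extTwo * (stateVec (k : ℤ) n).2.2)
  rw [Fintype.card_fin] at h
  rw [totalValue, ← h]
  refine Finset.sum_congr rfl fun c _ => ?_
  rw [extCount_graphH, stripCount_wheelFour, Fintype.card_fin]
  split_ifs
  · unfold quadValue
    split_ifs <;> rfl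
  · simp

theorem chromaticPolynomial_doubleEnded (n : ℕ)
    (hloop : ∀ x y, (graphH.graph ⊕g (triangularStrip (n + 1) ⊕g wheelFour.graph)).Adj x y →
      Quot.mk (GlueRel graphH wheelFour (n + 1) n.succ_pos) x ≠
        Quot.mk (GlueRel graphH wheelFour (n + 1) n.succ_pos) y) :
    chromaticPolynomial (doubleEnded graphH wheelFour (n + 1) n.succ_pos) =
      totalValue (Polynomial.X : Polynomial ℤ) n := by
  refine Polynomial.eq_of_infinite_eval_eq _ _ ?_
  refine (Set.infinite_range_of_injective (Nat.cast_injective (R := ℤ))).mono ?_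
  rintro _ ⟨k, rfl⟩
  simp only [Set.mem_ofPred]
  rw [chromaticPolynomial_eval, card_coloring_doubleEnded_graphH_wheelFour n k hloop]
  have := totalValue_map (Polynomial.evalRingHom (k : ℤ)) Polynomial.X n
  simpa using this.symm

theorem aeval_chromaticPolynomial_doubleEnded (n : ℕ)
    (hloop : ∀ x y, (graphH.graph ⊕g (triangularStrip (n + 1) ⊕g wheelFour.graph)).Adj x y →
      Quot.mk (GlueRel graphH wheelFour (n + 1) n.succ_pos) x ≠
        Quot.mk (GlueRel graphH wheelFour (n + 1) n.succ_pos) y) (q : ℝ) :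
    Polynomial.aeval q (chromaticPolynomial (doubleEnded graphH wheelFour (n + 1) n.succ_pos)) =
      totalValue q n := by
  rw [chromaticPolynomial_doubleEnded n hloop]
  have := totalValue_map (Polynomial.aeval (R := ℤ) q : Polynomial ℤ →ₐ[ℤ] ℝ).toRingHom
    Polynomial.X n
  simpa using this

/-! ### The sign of the chromatic polynomial near 4 -/

open Filter Topology

/-- A solution of a two-term recurrence with real roots `0 < μ < l` is eventually negative when
its component along the larger root is negative. -/
theorem eventually_neg_of_recurrence (u : ℕ → ℝ) (l μ : ℝ) (hμ : 0 < μ) (hl : μ < l)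
    (hu : ∀ n, u (n + 2) = (l + μ) * u (n + 1) - l * μ * u n) (h : u 1 < μ * u 0) :
    ∃ N, ∀ n > N, u n < 0 := by
  have hlm : 0 < l - μ := sub_pos.2 hl
  have closed : ∀ n, (l - μ) * u n = (u 1 - μ * u 0) * l ^ n - (u 1 - l * u 0) * μ ^ n := by
    have : ∀ n, (l - μ) * u n = (u 1 - μ * u 0) * l ^ n - (u 1 - l * u 0) * μ ^ n ∧
        (l - μ) * u (n + 1) =
          (u 1 - μ * u 0) * l ^ (n + 1) - (u 1 - l * u 0) * μ ^ (n + 1) := by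
      intro n
      induction n with
      | zero => constructor <;> simp <;> ring
      | succ n ih =>
        refine ⟨ih.2, ?_⟩
        rw [hu]
        linear_combination (l + μ) * ih.2 - l * μ * ih.1
    exact fun n => (this n).1
  have hlim : Tendsto (fun n : ℕ => (u 1 - μ * u 0) - (u 1 - l * u 0) * (μ / l) ^ n) atTop
      (𝓝 ((u 1 - μ * u 0) - (u 1 - l * u 0) * 0)) :=
    tendsto_const_nhds.sub (tendsto_const_nhds.mul (tendsto_pow_atTop_nhds_zero_of_lt_one
      (div_pos hμ (hμ.trans hl)).le ((div_lt_one (hμ.trans hl)).2 hl)))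
  have hneg : (u 1 - μ * u 0) - (u 1 - l * u 0) * 0 < 0 := by linarith
  obtain ⟨N, hN⟩ := eventually_atTop.1 (hlim.eventually (gt_mem_nhds hneg))
  refine ⟨N, fun n hn => ?_⟩
  have h1 := hN n hn.le
  have hln : 0 < l ^ n := pow_pos (hμ.trans hl) n
  have h2 : (l - μ) * u n = l ^ n * ((u 1 - μ * u 0) - (u 1 - l * u 0) * (μ / l) ^ n) := by
    rw [closed, div_pow]
    field_simp
  have h3 : (l - μ) * u n < 0 := h2 ▸ mul_neg_of_pos_of_neg hln h1
  by_contra h4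
  exact absurd h3 (not_lt.2 (mul_nonneg hlm.le (not_lt.1 h4)))

/-- The previous criterion in terms of the coefficients of the recurrence. -/
theorem eventually_neg_of_recurrence_coeff (u : ℕ → ℝ) (t d : ℝ)
    (hu : ∀ n, u (n + 2) = t * u (n + 1) - d * u n) (ht : 0 < t) (hd : 0 < d)
    (hdisc : 0 < t ^ 2 - 4 * d) (h1 : 0 < t * u 0 - 2 * u 1)
    (h2 : 0 < u 1 ^ 2 - t * u 0 * u 1 + d * u 0 ^ 2) : ∃ N, ∀ n > N, u n < 0 := by
  set s := √(t ^ 2 - 4 * d) with hs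
  have hs0 : 0 < s := Real.sqrt_pos.2 hdisc
  have hss : s ^ 2 = t ^ 2 - 4 * d := Real.sq_sqrt hdisc.le
  have hst : s < t := by
    refine lt_of_pow_lt_pow_left₀ 2 ht.le ?_
    rw [hss]
    linarith
  refine eventually_neg_of_recurrence u ((t + s) / 2) ((t - s) / 2) (by linarith) (by linarith)
    (fun n => ?_) ?_
  · rw [hu]
    linear_combination (-u n / 4) * hss
  -- The difference of the squares of the two sides is four times the quantity in `h2`, and `h1`
  -- makes the right side positive. The sign of `u 0` plays no role. The inequality says that `u 1`
  -- is less than the smaller root times `u 0`.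
  · have : s * u 0 < t * u 0 - 2 * u 1 := by
      refine lt_of_pow_lt_pow_left₀ 2 h1.le ?_
      rw [mul_pow, hss]
      nlinarith
    linarith

theorem continuous_polyEval (l : List ℤ) : Continuous fun x : ℝ => polyEval x l := by
  induction l with
  | nil => exact continuous_const
  | cons a l ih => exact continuous_const.add (continuous_id.mul ih)

/-- For a planar graph the extension counts on a bounding 4-cycle are combinations of 1, [c₀ = c₂]
and [c₁ = c₃], the crossing partition being excluded. On each of these the four-colour and
two-colour values add up to the sum of the two three-colour values. Here it suffices that the wheel
satisfies the relation and that the transfer preserves it. -/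
theorem stateVec_planar {R : Type*} [CommRing R] (q : R) (n : ℕ) :
    2 * (stateVec q n).2.1 = (stateVec q n).1 + (stateVec q n).2.2 := by
  induction n with
  | zero => simp only [stateVec]; ring
  | succ n ih =>
    simp only [stateVec, transfer, polyEval]
    push_cast
    linear_combination 2 * ih

/-- At `q = 4` the transfer matrix is twice the identity on the plane of `stateVec_planar`; the two
eigenvalues collide there. -/
theorem stateVec_four (n : ℕ) : stateVec (4 : ℝ) n = (0, 2 ^ n, 2 * 2 ^ n) := by
  induction n with
  | zero => norm_num [stateVec]
  | succ n ih =>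
    rw [stateVec, ih]
    simp only [transfer, polyEval, Prod.mk.injEq]
    refine ⟨?_, ?_, ?_⟩ <;> push_cast <;> ring

theorem totalValue_four_pos (n : ℕ) : 0 < totalValue (4 : ℝ) n := by
  have : totalValue (4 : ℝ) n = 432 * 2 ^ n := by
    rw [totalValue, stateVec_four]
    simp only [polyEval, extFour, extThree, extTwo]
    push_cast
    ring
  rw [this]
  positivity

/-- The coefficient of the first component of the state vector in `totalValue (4 - x)`, divided
after subtracting its constant term `648` by `x`. -/
def firstTail : List ℤ :=
  [-6846, 33131, -99821, 211497, -332311, 397432, -369078, 270630, -157910, 73104, -26584, 7464,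
    -1568, 233, -22, 1]

/-- The coefficient of the last component of the state vector in `totalValue (4 - x)`, divided
after subtracting its constant term `216` by `x`. -/
def lastTail : List ℤ :=
  [-2778, 15365, -49095, 103204, -154090, 171514, -146295, 96759, -49726, 19760, -5984, 1341,
    -211, 21, -1]

/-- The planar relation eliminates the three-colour component. The relation 648 = 3 · 216 between
the constant terms is the property of `graphH` that makes the theorem work: it kills the dominant
amplitude to leading order. -/
theorem totalValue_four_sub (x : ℝ) (n : ℕ) :
    totalValue (4 - x) n = (648 + x * polyEval x firstTail) * (stateVec (4 - x) n).1 +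
      (216 + x * polyEval x lastTail) * (stateVec (4 - x) n).2.2 := by
  have h := stateVec_planar (4 - x) n
  have e1 : polyEval (4 - x) [0, -6, 11, -6, 1] * polyEval (4 - x) extFour +
      polyEval (4 - x) [0, 2, -3, 1] * polyEval (4 - x) extThree =
      648 + x * polyEval x firstTail := by
    simp only [polyEval, extFour, extThree, firstTail]
    push_cast
    ring
  have e2 : polyEval (4 - x) [0, -1, 1] * polyEval (4 - x) extTwo +
      polyEval (4 - x) [0, 2, -3, 1] * polyEval (4 - x) extThree =
      216 + x * polyEval x lastTail := by
    simp only [polyEval, extTwo, extThree, lastTail]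
    push_cast
    ring
  rw [totalValue, ← e1, ← e2]
  linear_combination (polyEval (4 - x) [0, 2, -3, 1] * polyEval (4 - x) extThree) * h

theorem stateVec_four_sub_succ (x : ℝ) (n : ℕ) :
    (stateVec (4 - x) (n + 1)).1 =
      (2 - 8 * x + 8 * x ^ 2 - 3 * x ^ 3 + x ^ 4) * (stateVec (4 - x) n).1 +
      x * (-1 + x * (2 - x)) * (stateVec (4 - x) n).2.2 ∧
    (stateVec (4 - x) (n + 1)).2.2 =
      x ^ 2 * (2 - 3 * x + x ^ 2) * (stateVec (4 - x) n).1 +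
      (2 - 5 * x + 4 * x ^ 2 - x ^ 3) * (stateVec (4 - x) n).2.2 := by
  have h := stateVec_planar (4 - x) n
  constructor
  · simp only [stateVec, transfer, polyEval]
    push_cast
    linear_combination (-56 + 42 * (4 - x) - 11 * (4 - x) ^ 2 + (4 - x) ^ 3) * h
  · simp only [stateVec, transfer, polyEval]
    push_cast
    linear_combination (-24 + 26 * (4 - x) - 9 * (4 - x) ^ 2 + (4 - x) ^ 3) * h

theorem exists_totalValue_neg :
    ∃ ε₀ : ℝ, 0 < ε₀ ∧ ∀ ε : ℝ, 0 < ε → ε < ε₀ →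
      ∃ N : ℕ, ∀ n > N, totalValue (4 - ε) n < 0 := by
  have cf := continuous_polyEval firstTail
  have cg := continuous_polyEval lastTail
  set f : ℝ → ℝ := fun x => polyEval x firstTail with hf
  set g : ℝ → ℝ := fun x => polyEval x lastTail with hg
  have f0 : f 0 = -6846 := by simp [hf, firstTail, polyEval]
  have g0 : g 0 = -2778 := by simp [hg, lastTail, polyEval]
  have ev : ∀ F : ℝ → ℝ, Continuous F → 0 < F 0 → ∀ᶠ x in 𝓝 (0 : ℝ), 0 < F x :=
    fun F hF h => hF.continuousAt.eventually (lt_mem_nhds h)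
  -- Write T for the 2×2 matrix of `stateVec_four_sub_succ`, v = (-x, 2 - x) for the initial vector
  -- and w = (648 + x f, 216 + x g) for the covector, so that u n = w Tⁿ v. `E1` and `E2` are the
  -- trace and the determinant of T; the other quantities are hypotheses of the recurrence
  -- criterion, or their factors, divided by the powers of x that they contain.
  have E1 := ev (fun x => 4 - 13 * x + 12 * x ^ 2 - 4 * x ^ 3 + x ^ 4) (by fun_prop) (by norm_num)
  have E2 := ev (fun x => (2 - 8 * x + 8 * x ^ 2 - 3 * x ^ 3 + x ^ 4) *
    (2 - 5 * x + 4 * x ^ 2 - x ^ 3) - x * (-1 + x * (2 - x)) * (x ^ 2 * (2 - 3 * x + x ^ 2)))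
    (by fun_prop) (by norm_num)
  -- The discriminant of T divided by x²; it is 9 at x = 0.
  have E3 := ev (fun x => (3 + x * (-4 + 2 * x - x ^ 2)) ^ 2 +
    4 * x * (-1 + x * (2 - x)) * (2 - 3 * x + x ^ 2)) (by fun_prop) (by norm_num)
  -- This is w (tr T - 2 T) v divided by x, where all entries of tr T - 2 T are divisible by x.
  have E5 := ev (fun x => -(648 + x * f x) * x * (3 + x * (-4 + 2 * x - x ^ 2)) -
    (216 + x * g x) * (2 - x) * (3 + x * (-4 + 2 * x - x ^ 2)) -
    2 * (648 + x * f x) * (-1 + x * (2 - x)) * (2 - x) +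
    2 * (216 + x * g x) * x ^ 2 * (2 - 3 * x + x ^ 2)) (by fun_prop) (by norm_num)
  -- Up to the factor -x² this is the determinant with rows w and wT. One factor x comes from T, the
  -- other from 3 (216 + x g) - (648 + x f) = x (3 g - f). Since the leading order cancels, the
  -- linear terms of w decide the sign.
  have E6 := ev (fun x => -((648 + x * f x) * (3 * g x - f x) + (648 + x * f x) ^ 2 * (2 - x) +
    (648 + x * f x) * (216 + x * g x) * (-4 + 2 * x - x ^ 2) -
    (216 + x * g x) ^ 2 * (2 - 3 * x + x ^ 2))) (by fun_prop) (by simp [f0, g0]; norm_num)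
  -- The determinant with columns v and Tv, divided by x.
  have E7 := ev (fun x => x ^ 3 * (2 - 3 * x + x ^ 2) -
    (2 - x) * x * (3 + x * (-4 + 2 * x - x ^ 2)) - (2 - x) ^ 2 * (-1 + x * (2 - x)))
    (by fun_prop) (by norm_num)
  obtain ⟨ε₀, h0, hε⟩ := Metric.eventually_nhds_iff.1
    (E1.and (E2.and (E3.and (E5.and (E6.and E7)))))
  refine ⟨ε₀, h0, fun x hx hx' => ?_⟩
  obtain ⟨e1, e2, e3, e5, e6, e7⟩ := hε (y := x) (by
    rw [Real.dist_eq, sub_zero, abs_of_pos hx]; exact hx')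
  have hu := totalValue_four_sub x
  have hs := stateVec_four_sub_succ x
  have v0 : (stateVec (4 - x) 0).1 = -x := by simp [stateVec]
  have v0' : (stateVec (4 - x) 0).2.2 = 2 - x := by simp only [stateVec]; ring
  have u0 : totalValue (4 - x) 0 = (648 + x * f x) * (-x) + (216 + x * g x) * (2 - x) := by
    rw [hu, v0, v0']
  have u1 : totalValue (4 - x) 1 = (648 + x * f x) *
      ((2 - 8 * x + 8 * x ^ 2 - 3 * x ^ 3 + x ^ 4) * (-x) + x * (-1 + x * (2 - x)) * (2 - x)) +
      (216 + x * g x) * (x ^ 2 * (2 - 3 * x + x ^ 2) * (-x) +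
        (2 - 5 * x + 4 * x ^ 2 - x ^ 3) * (2 - x)) := by
    rw [hu, (hs 0).1, (hs 0).2, v0, v0']
  refine eventually_neg_of_recurrence_coeff (fun n => totalValue (4 - x) n)
    (4 - 13 * x + 12 * x ^ 2 - 4 * x ^ 3 + x ^ 4)
    ((2 - 8 * x + 8 * x ^ 2 - 3 * x ^ 3 + x ^ 4) * (2 - 5 * x + 4 * x ^ 2 - x ^ 3) -
      x * (-1 + x * (2 - x)) * (x ^ 2 * (2 - 3 * x + x ^ 2))) ?_ e1 e2 ?_ ?_ ?_
  · intro n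
    simp only [hu]
    rw [(hs (n + 1)).1, (hs (n + 1)).2, (hs n).1, (hs n).2]
    ring
  · have := mul_pos (pow_pos hx 2) e3
    refine this.trans_eq ?_
    ring
  · have := mul_pos hx e5
    refine this.trans_eq ?_
    simp only [u0, u1]
    ring
  -- The Hankel determinant u₀u₂ - u₁² is the product of the determinants of (w, wT) and (v, Tv).
  -- Its negative is the quantity required, which is therefore x³ times the product of the two
  -- positive factors.
  · have := mul_pos (pow_pos hx 3) (mul_pos e6 e7)
    refine this.trans_eq ?_
    simp only [u0, u1]
    ring

theorem continuous_totalValue (n : ℕ) : Continuous fun q : ℝ => totalValue q n := by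
  have : ∀ q : ℝ, totalValue q n =
      Polynomial.aeval q (totalValue (Polynomial.X : Polynomial ℤ) n) := by
    intro q
    have := totalValue_map (Polynomial.aeval (R := ℤ) q : Polynomial ℤ →ₐ[ℤ] ℝ).toRingHom
      Polynomial.X n
    simpa using this.symm
  simp only [this]
  exact Polynomial.continuous_aeval _

theorem exists_root (δ : ℝ) (hδ : 0 < δ) :
    ∃ N : ℕ, ∀ n > N, ∃ x : ℝ, 4 - δ < x ∧ x < 4 ∧ totalValue x n = 0 := by
  obtain ⟨ε₀, h0, h⟩ := exists_totalValue_neg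
  have hm : 0 < min ε₀ δ := lt_min h0 hδ
  obtain ⟨N, hN⟩ := h (min ε₀ δ / 2) (by linarith) (by linarith [min_le_left ε₀ δ])
  refine ⟨N, fun n hn => ?_⟩
  obtain ⟨x, ⟨hx1, hx2⟩, hx⟩ := intermediate_value_Ioo (a := 4 - min ε₀ δ / 2) (b := 4)
    (by linarith) (continuous_totalValue n).continuousOn
    (show (0 : ℝ) ∈ Set.Ioo _ _ from ⟨hN n hn, totalValue_four_pos n⟩)
  exact ⟨x, by linarith [min_le_right ε₀ δ], hx2, hx⟩

end ColorCount

/-! ### Triangulations from cyclic lists of neighbours -/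

namespace RotationSystem

/-- The pairs of cyclically consecutive entries of a list. -/
def cyclicPairs {α : Type*} (l : List α) : List (α × α) := l.zip (l.rotate 1)

/-- The bridge between a condition on explicit lists, which `simp` can check, and the permutation
that turns darts. -/
theorem mem_cyclicPairs_iff {α : Type*} [DecidableEq α] {l : List α} (hl : l.Nodup) (a b : α) :
    (a, b) ∈ cyclicPairs l ↔ a ∈ l ∧ l.formPerm a = b := by
  rw [cyclicPairs, List.mem_iff_getElem]
  constructor
  · rintro ⟨k, hk, h⟩
    have hk' : k < l.length := by simpa using hk
    rw [List.getElem_zip, Prod.mk.injEq, List.getElem_rotate] at h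
    refine ⟨h.1 ▸ List.getElem_mem _, ?_⟩
    rw [← h.1, List.formPerm_apply_getElem _ hl, h.2]
  · rintro ⟨ha, hb⟩
    obtain ⟨k, hk, rfl⟩ := List.mem_iff_getElem.1 ha
    rw [List.formPerm_apply_getElem _ hl] at hb
    refine ⟨k, by simpa using hk, ?_⟩
    rw [List.getElem_zip, List.getElem_rotate, hb]

theorem cyclicPairs_map {α β : Type*} (f : α → β) (l : List α) :
    cyclicPairs (l.map f) = (cyclicPairs l).map (Prod.map f f) := by
  rw [cyclicPairs, cyclicPairs, ← List.map_rotate, List.zip_map]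

variable {V : Type*} [DecidableEq V] {G : SimpleGraph V}

/-- The permutation of the darts that turns each of them according to the cyclic order given by a
list of neighbours. -/
def turn (rot : V → List V) (hadj : ∀ u v, G.Adj u v ↔ v ∈ rot u) : Equiv.Perm G.Dart where
  toFun d := ⟨(d.fst, (rot d.fst).formPerm d.snd),
    (hadj _ _).2 (List.formPerm_mem_iff_mem.2 ((hadj _ _).1 d.adj))⟩
  invFun d := ⟨(d.fst, (rot d.fst).formPerm.symm d.snd),
    (hadj _ _).2 (List.formPerm_mem_iff_mem.1 (by
      rw [Equiv.apply_symm_apply]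
      exact (hadj _ _).1 d.adj))⟩
  left_inv d := by
    ext
    · rfl
    · exact Equiv.symm_apply_apply _ _
  right_inv d := by
    ext
    · rfl
    · exact Equiv.apply_symm_apply _ _

theorem turn_pow_apply (rot : V → List V) (hadj : ∀ u v, G.Adj u v ↔ v ∈ rot u) (d : G.Dart)
    (k : ℕ) : ((turn rot hadj ^ k) d).fst = d.fst ∧
      ((turn rot hadj ^ k) d).snd = ((rot d.fst).formPerm ^ k) d.snd := by
  induction k with
  | zero => exact ⟨rfl, rfl⟩
  | succ k ih =>
    rw [pow_succ', pow_succ', Equiv.Perm.mul_apply, Equiv.Perm.mul_apply, ← ih.2]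
    refine ⟨ih.1, ?_⟩
    change (rot ((turn rot hadj ^ k) d).fst).formPerm ((turn rot hadj ^ k) d).snd = _
    rw [ih.1]

/-- The rotation system in which the neighbours of each vertex appear in the cyclic order of a
given list. -/
def ofLists (rot : V → List V) (hrot : ∀ v, (rot v).Nodup)
    (hadj : ∀ u v, G.Adj u v ↔ v ∈ rot u) : RotationSystem G where
  next := turn rot hadj
  next_fst d := rfl
  sameCycle d e h := by
    have hc : (rot d.fst).formPerm.IsCycleOn ((rot d.fst).toFinset : Set V) := by
      simpa using (hrot d.fst).isCycleOn_formPerm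
    obtain ⟨k, -, hk⟩ := hc.exists_pow_eq (a := d.snd) (b := e.snd)
      (by simpa using (hadj _ _).1 d.adj) (by simpa [h] using (hadj _ _).1 e.adj)
    refine ⟨k, ?_⟩
    rw [zpow_natCast]
    have := turn_pow_apply rot hadj d k
    ext
    · exact this.1.trans h
    · exact this.2.trans hk

theorem sameCycle_iff_of_pow_three {α : Type*} (f : Equiv.Perm α) (h3 : ∀ x, f (f (f x)) = x)
    (x y : α) : f.SameCycle x y ↔ y = x ∨ y = f x ∨ y = f (f x) := by
  constructor
  · rintro ⟨k, rfl⟩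
    have key : ∀ k : ℕ, (f ^ k) x = x ∨ (f ^ k) x = f x ∨ (f ^ k) x = f (f x) := by
      intro k
      induction k with
      | zero => exact Or.inl rfl
      | succ k ih =>
        rw [pow_succ', Equiv.Perm.mul_apply]
        rcases ih with h | h | h <;> rw [h]
        · exact Or.inr (Or.inl rfl)
        · exact Or.inr (Or.inr rfl)
        · exact Or.inl (h3 x)
    have hf : f ^ (3 : ℕ) = 1 := Equiv.ext h3
    have : f ^ k = f ^ (k % 3).toNat := by
      have h := Int.emod_add_mul_ediv k 3
      have h' : 0 ≤ k % 3 := Int.emod_nonneg _ (by norm_num)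
      conv_lhs => rw [← h, zpow_add, zpow_mul, show (3 : ℤ) = ((3 : ℕ) : ℤ) from rfl,
        zpow_natCast f 3, hf, one_zpow, mul_one]
      rw [← zpow_natCast, Int.toNat_of_nonneg h']
      rfl
    rw [this]
    exact key _
  · rintro (rfl | rfl | rfl)
    · exact Equiv.Perm.SameCycle.refl _ _
    · exact ⟨1, rfl⟩
    · exact ⟨2, rfl⟩

theorem card_of_orbits {α : Type*} [Finite α] (f : Equiv.Perm α) (k : ℕ)
    (h : ∀ x, {y | f.SameCycle x y}.ncard = k) :
    Nat.card α = Nat.card (Quotient (Equiv.Perm.SameCycle.setoid f)) * k := by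
  classical
  have := Fintype.ofFinite α
  have := Fintype.ofFinite (Quotient (Equiv.Perm.SameCycle.setoid f))
  rw [Nat.card_congr (Equiv.sigmaFiberEquiv (Quotient.mk (Equiv.Perm.SameCycle.setoid f))).symm,
    Nat.card_sigma, Finset.sum_congr rfl (g := fun _ => k), Finset.sum_const, Finset.card_univ,
    smul_eq_mul, Nat.card_eq_fintype_card]
  intro q _
  induction q using Quotient.ind with
  | _ x =>
    rw [← h x, ← Nat.card_coe_set_eq]
    refine Nat.card_congr (Equiv.subtypeEquivRight fun y => ?_)
    rw [Quotient.eq]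
    exact Equiv.Perm.sameCycle_comm

/-- If b follows a around v, then `htri` says that a follows v around b, and applied again that v
follows b around a. So face tracing runs through (a, v), (v, b), (b, a) and closes up after three
steps. Hence 3F = 2E, and Euler's formula becomes 2E + 12 = 6V, which is `hcount`. -/
theorem isPlanarTriangulation_of_lists [Finite V] (rot : V → List V)
    (hrot : ∀ v, (rot v).Nodup) (hadj : ∀ u v, G.Adj u v ↔ v ∈ rot u)
    (htri : ∀ v, ∀ p ∈ cyclicPairs (rot v), (v, p.1) ∈ cyclicPairs (rot p.2))
    (hconn : G.Connected)
    (hcount : ∑ᶠ v, (rot v).length + 12 = 6 * Nat.card V) : IsPlanarTriangulation G := by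
  classical
  have := Fintype.ofFinite V
  have htri' : ∀ u v, G.Adj u v → (rot ((rot v).formPerm u)).formPerm v = u := by
    intro u v h
    exact ((mem_cyclicPairs_iff (hrot _) _ _).1 (htri v (u, (rot v).formPerm u)
      ((mem_cyclicPairs_iff (hrot _) _ _).2 ⟨(hadj _ _).1 h.symm, rfl⟩))).2
  set R := ofLists rot hrot hadj with hR
  have hface : ∀ d : G.Dart, (R.facePerm d).fst = d.snd ∧
      (R.facePerm d).snd = (rot d.snd).formPerm d.fst := fun d => ⟨rfl, rfl⟩
  have h3 : ∀ d, R.facePerm (R.facePerm (R.facePerm d)) = d := by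
    intro d
    have h1 := htri' _ _ d.adj
    have h2 := htri' _ _ (R.facePerm d).adj
    have e : (rot (R.facePerm d).snd).formPerm (R.facePerm d).fst = d.fst := by
      rw [(hface d).1, (hface d).2, h1]
    rw [e, (hface d).1, (hface d).2] at h2
    ext
    · rw [(hface _).1, (hface _).2, e]
    · rw [(hface _).2, (hface _).2, (hface (R.facePerm d)).1, e, (hface d).2, h2]
  have hne : ∀ d, R.facePerm d ≠ d := by
    intro d h
    have := congrArg (fun d : G.Dart => d.fst) h
    rw [(hface d).1] at this
    exact d.adj.ne this.symm
  have horb : ∀ d : G.Dart, {e : G.Dart | R.facePerm.SameCycle d e}.ncard = 3 := by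
    intro d
    have : {e : G.Dart | R.facePerm.SameCycle d e} =
        {d, R.facePerm d, R.facePerm (R.facePerm d)} := by
      ext e
      simp [sameCycle_iff_of_pow_three R.facePerm h3]
    rw [this, Set.ncard_eq_three]
    refine ⟨_, _, _, (hne d).symm, ?_, (hne _).symm, rfl⟩
    intro h
    have := congrArg R.facePerm h
    rw [h3] at this
    exact hne d this
  refine ⟨hconn, R, ?_, horb⟩
  have hF := card_of_orbits R.facePerm 3 horb
  change Nat.card G.Dart = Nat.card R.Face * 3 at hF
  have hE : Nat.card G.Dart = 2 * Nat.card G.edgeSet := by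
    rw [Nat.card_eq_fintype_card, G.dart_card_eq_twice_card_edges, Nat.card_eq_fintype_card,
      SimpleGraph.edgeFinset, Set.toFinset_card]
  have hD : Nat.card G.Dart = ∑ᶠ v, (rot v).length := by
    rw [Nat.card_eq_fintype_card, G.dart_card_eq_sum_degrees, finsum_eq_sum_of_fintype]
    refine Finset.sum_congr rfl fun v _ => ?_
    rw [← G.card_neighborFinset_eq_degree, ← List.toFinset_card_of_nodup (hrot v)]
    congr 1
    ext w
    simp [hadj]
  omega

/-- Transports the criterion to coordinates, so that the lists need not be written in a quotient
type. Outside the range of `c` nothing is required. -/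
theorem isPlanarTriangulation_of_code {V K : Type*} [Finite V] [DecidableEq K] {G : SimpleGraph V}
    (c : V → K) (r : K → V) (R : K → List K) (hrc : ∀ v, r (c v) = v)
    (hcr : ∀ v, ∀ b ∈ R (c v), c (r b) = b) (hR : ∀ v, (R (c v)).Nodup)
    (hadj : ∀ u v, G.Adj u v ↔ c v ∈ R (c u))
    (htri : ∀ v, ∀ p ∈ cyclicPairs (R (c v)), (c v, p.1) ∈ cyclicPairs (R p.2))
    (hconn : G.Connected)
    (hcount : ∑ᶠ v, (R (c v)).length + 12 = 6 * Nat.card V) : IsPlanarTriangulation G := by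
  classical
  refine isPlanarTriangulation_of_lists (fun v => (R (c v)).map r) (fun v => ?_) (fun u v => ?_)
    (fun v => ?_) hconn (by simpa using hcount)
  · refine (hR v).map_on fun a ha b hb h => ?_
    rw [← hcr v a ha, ← hcr v b hb, h]
  · rw [hadj, List.mem_map]
    constructor
    · exact fun h => ⟨c v, h, hrc v⟩
    · rintro ⟨a, ha, rfl⟩
      rwa [hcr u a ha]
  · intro p hp
    rw [cyclicPairs_map] at hp
    obtain ⟨⟨a, b⟩, hab, rfl⟩ := List.mem_map.1 hp
    have hb : b ∈ R (c v) := by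
      have := (List.of_mem_zip hab).2
      simpa using this
    rw [Prod.map_snd, Prod.map_fst]
    rw [hcr v b hb, cyclicPairs_map]
    refine List.mem_map.2 ⟨(c v, a), htri v _ hab, ?_⟩
    rw [Prod.map_apply, hrc]

/-! ### The rotation system in layered coordinates -/

/-- The neighbours above a vertex of the strip, from left to right, in layered coordinates: the
layers `0`, `1`, `2` are the 4-cycle `t` and the vertices `m`, `q` of `graphH`. -/
def nbrsAbove (k : ℕ) (i : Fin 4) : List (ℕ × Fin 4) :=
  if k = 0 then [(1, i + 3), (2, i), (1, i)] else [(k + 2, i + 3), (k + 2, i)]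

/-- The neighbours below a vertex of the strip, from right to left; the hub of the wheel is
`(n + 3, 0)`. -/
def nbrsBelow (n k : ℕ) (i : Fin 4) : List (ℕ × Fin 4) :=
  if k + 1 = n then [(n + 3, 0)] else [(k + 4, i + 1), (k + 4, i)]

/-- The neighbours of a vertex in cyclic order, in layered coordinates. -/
def layeredNbrs (n : ℕ) : ℕ × Fin 4 → List (ℕ × Fin 4)
  | (0, i) => (2, i) :: (0, i + 3) :: ((if i = 0 ∨ i = 2 then [(0, i + 2)] else []) ++
      [(0, i + 1), (2, i + 1), (1, i)])
  | (1, i) => [(3, i), (2, i), (0, i), (2, i + 1), (3, i + 1)]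
  | (2, i) => [(3, i), (1, i + 3), (0, i + 3), (0, i), (1, i)]
  | (k + 3, i) => if k = n then [(n + 2, 0), (n + 2, 1), (n + 2, 2), (n + 2, 3)] else
      (k + 3, i + 1) :: (nbrsBelow n k i ++ (k + 3, i + 3) :: nbrsAbove k i)

/-- The coordinates that belong to vertices. -/
def IsCode (n : ℕ) (a : ℕ × Fin 4) : Prop := a.1 < n + 3 ∨ a = (n + 3, 0)

theorem layeredNbrs_nodup (n : ℕ) (a : ℕ × Fin 4) : (layeredNbrs n a).Nodup := by
  obtain ⟨j, i⟩ := a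
  match j with
  | 0 => simp only [layeredNbrs]; revert i; decide
  | 1 => simp only [layeredNbrs]; revert i; decide
  | 2 => simp only [layeredNbrs]; revert i; decide
  | k + 3 =>
    simp only [layeredNbrs, nbrsBelow, nbrsAbove]
    split_ifs <;> (fin_cases i <;> simp <;> omega)

theorem isCode_of_mem_layeredNbrs (n : ℕ) (hn : 0 < n) (a b : ℕ × Fin 4) (ha : IsCode n a)
    (hb : b ∈ layeredNbrs n a) : IsCode n b := by
  obtain ⟨j, i⟩ := a
  have : b.1 < n + 3 ∨ b = (n + 3, 0) := by
    match j with
    | 0 =>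
      have : ∀ i : Fin 4, ∀ b ∈ layeredNbrs n (0, i), b.1 < 3 := by
        simp only [layeredNbrs]; decide
      have := this i b hb
      omega
    | 1 =>
      have : ∀ i : Fin 4, ∀ b ∈ layeredNbrs n (1, i), b.1 < 4 := by
        simp only [layeredNbrs]; decide
      have := this i b hb
      omega
    | 2 =>
      have : ∀ i : Fin 4, ∀ b ∈ layeredNbrs n (2, i), b.1 < 4 := by
        simp only [layeredNbrs]; decide
      have := this i b hb
      omega
    | k + 3 =>
      have hk : k ≤ n := by
        rcases ha with h | h
        · simp only at h; omega
        · simp only [Prod.mk.injEq] at h; omega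
      simp only [layeredNbrs, nbrsBelow, nbrsAbove] at hb
      split_ifs at hb <;> simp only [List.mem_cons, List.cons_append, List.nil_append,
        List.not_mem_nil, or_false] at hb <;> rcases hb with rfl | rfl | rfl | rfl | rfl | rfl | rfl
        <;> simp <;> omega
  exact this

/-- A local check. The form of a list changes only at the seam with `graphH` and near the hub, so
the proof separates the layers next to these two places, including very short strips where they
interact, from the generic layer. -/
theorem layeredNbrs_triangle (n : ℕ) (hn : 0 < n) (a : ℕ × Fin 4) (ha : IsCode n a) :
    ∀ p ∈ cyclicPairs (layeredNbrs n a), (a, p.1) ∈ cyclicPairs (layeredNbrs n p.2) := by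
  obtain ⟨j, i⟩ := a
  match j with
  | 0 => fin_cases i <;> simp [cyclicPairs, layeredNbrs]
  | 1 =>
    by_cases h : n = 1
    · subst h
      fin_cases i <;> simp [cyclicPairs, layeredNbrs, nbrsBelow, nbrsAbove]
    · have h0 : 0 ≠ n := by omega
      have h1 : 1 ≠ n := by omega
      fin_cases i <;> simp [cyclicPairs, layeredNbrs, nbrsBelow, nbrsAbove, h0, h1]
  | 2 =>
    by_cases h : n = 1
    · subst h
      fin_cases i <;> simp [cyclicPairs, layeredNbrs, nbrsBelow, nbrsAbove]
    · have h0 : 0 ≠ n := by omega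
      have h1 : 1 ≠ n := by omega
      fin_cases i <;> simp [cyclicPairs, layeredNbrs, nbrsBelow, nbrsAbove, h0, h1]
  | k + 3 =>
    rcases Nat.lt_trichotomy k n with hk | rfl | hk
    · have h0 : k ≠ n := hk.ne
      rcases k with _ | k
      · by_cases h1 : 1 = n
        · subst h1
          fin_cases i <;> simp [cyclicPairs, layeredNbrs, nbrsBelow, nbrsAbove]
        · have h2 : 0 ≠ n := hn.ne
          by_cases h3 : 2 = n
          · subst h3
            fin_cases i <;> simp [cyclicPairs, layeredNbrs, nbrsBelow, nbrsAbove]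
          · fin_cases i <;>
              simp [cyclicPairs, layeredNbrs, nbrsBelow, nbrsAbove, h1, h2, h3]
      · have h2 : k ≠ n := by omega
        by_cases h1 : k + 2 = n
        · subst h1
          fin_cases i <;> simp [cyclicPairs, layeredNbrs, nbrsBelow, nbrsAbove]
        · by_cases h3 : k + 3 = n
          · subst h3
            fin_cases i <;> simp [cyclicPairs, layeredNbrs, nbrsBelow, nbrsAbove]
          · fin_cases i <;>
              simp [cyclicPairs, layeredNbrs, nbrsBelow, nbrsAbove, h0, h1, h2, h3]
    · obtain rfl : i = 0 := by
        rcases ha with h | h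
        · simp at h
        · simpa using h
      obtain ⟨m, rfl⟩ : ∃ m, k = m + 1 := ⟨k - 1, by omega⟩
      rcases m with _ | m <;> simp [cyclicPairs, layeredNbrs, nbrsBelow, nbrsAbove]
    · rcases ha with h | h <;> simp at h <;> omega

/-- Symmetry of adjacency follows from the triangle condition: if `b` comes after `c` around `a`,
then `c` comes after `a` around `b`, so `a` is in the list of `b`. -/
theorem mem_layeredNbrs_comm {n : ℕ} (hn : 0 < n) {a b : ℕ × Fin 4} (ha : IsCode n a)
    (h : b ∈ layeredNbrs n a) : a ∈ layeredNbrs n b := by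
  have hnd := layeredNbrs_nodup n a
  set f := (layeredNbrs n a).formPerm with hf
  have hb : f.symm b ∈ layeredNbrs n a :=
    List.formPerm_mem_iff_mem.1 (by rwa [← hf, Equiv.apply_symm_apply])
  have := layeredNbrs_triangle n hn a ha (f.symm b, b)
    ((mem_cyclicPairs_iff hnd _ _).2 ⟨hb, by rw [← hf, Equiv.apply_symm_apply]⟩)
  exact (List.of_mem_zip this).1

theorem notMem_layeredNbrs_self (n : ℕ) (a : ℕ × Fin 4) : a ∉ layeredNbrs n a := by
  obtain ⟨j, i⟩ := a
  match j with
  | 0 => simp only [layeredNbrs]; revert i; decide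
  | 1 => simp only [layeredNbrs]; revert i; decide
  | 2 => simp only [layeredNbrs]; revert i; decide
  | k + 3 =>
    simp only [layeredNbrs, nbrsBelow, nbrsAbove]
    split_ifs <;> (fin_cases i <;> simp <;> omega)

/-! ### The glued graph is the graph of the lists -/

/-- The layered coordinates of the vertices of `graphH`. -/
def codeH (u : Fin 16) : ℕ × Fin 4 := (3 - u.val / 4, Fin.ofNat 4 u.val)

/-- The layered coordinates of the vertices of the wheel. -/
def codeW (n : ℕ) (w : Fin 5) : ℕ × Fin 4 :=
  if w = 4 then (n + 3, 0) else (n + 2, Fin.ofNat 4 w.val)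

/-- The layered coordinates before gluing. -/
def preCode (n : ℕ) : Fin 16 ⊕ (Fin n × Fin 4) ⊕ Fin 5 → ℕ × Fin 4 :=
  Sum.elim codeH (Sum.elim (fun p => (p.1.val + 3, p.2)) (codeW n))

/-- The layered coordinates of the vertices of the double-ended strip. -/
def code (n : ℕ) (hn : 0 < n) : DoubleEndedVertex graphH wheelFour n hn → ℕ × Fin 4 :=
  Quot.lift (preCode n) (by
    rintro _ _ (i | i)
    · fin_cases i <;> rfl
    · have : n - 1 + 3 = n + 2 := by omega
      fin_cases i <;> exact Prod.ext this rfl)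

/-- The vertex with given layered coordinates. -/
def decode (n : ℕ) (hn : 0 < n) (a : ℕ × Fin 4) : DoubleEndedVertex graphH wheelFour n hn :=
  if a.1 < 3 then Quot.mk _ (.inl (Fin.ofNat 16 (4 * (3 - a.1) + a.2.val)))
  else if h : a.1 - 3 < n then Quot.mk _ (.inr (.inl (⟨a.1 - 3, h⟩, a.2)))
  else Quot.mk _ (.inr (.inr 4))

theorem decode_codeH (n : ℕ) (hn : 0 < n) (u : Fin 16) :
    decode n hn (codeH u) = Quot.mk _ (.inl u) := by
  have top : ∀ i : Fin 4, decode n hn (3, i) = Quot.mk _ (.inl (graphH.corner i)) := by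
    intro i
    rw [Quot.sound (GlueRel.top (A := graphH) (B := wheelFour) (n := n) (hn := hn) i)]
    simp [decode, hn]
  fin_cases u
  · exact top 0
  · exact top 1
  · exact top 2
  · exact top 3
  all_goals rfl

theorem decode_strip (n : ℕ) (hn : 0 < n) (j : Fin n) (i : Fin 4) :
    decode n hn (j.val + 3, i) = Quot.mk _ (.inr (.inl (j, i))) := by
  simp [decode]

theorem decode_codeW (n : ℕ) (hn : 0 < n) (w : Fin 5) :
    decode n hn (codeW n w) = Quot.mk _ (.inr (.inr w)) := by
  have bottom : ∀ i : Fin 4, decode n hn (n + 2, i) =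
      Quot.mk _ (.inr (.inr (wheelFour.corner i))) := by
    intro i
    rw [← Quot.sound (GlueRel.bottom (A := graphH) (B := wheelFour) (n := n) (hn := hn) i),
      ← decode_strip]
    congr 2
    dsimp only
    omega
  fin_cases w
  · exact bottom 0
  · exact bottom 1
  · exact bottom 2
  · exact bottom 3
  · simp [codeW, decode]

theorem decode_code (n : ℕ) (hn : 0 < n) (v : DoubleEndedVertex graphH wheelFour n hn) :
    decode n hn (code n hn v) = v := by
  induction v using Quot.ind with
  | mk x =>
    rcases x with u | ⟨j, i⟩ | w
    · exact decode_codeH n hn u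
    · exact decode_strip n hn j i
    · exact decode_codeW n hn w

theorem exists_codeH_eq (a : ℕ × Fin 4) (h : a.1 ≤ 3) : ∃ u, codeH u = a := by
  obtain ⟨j, i⟩ := a
  refine ⟨Fin.ofNat 16 (4 * (3 - j) + i.val), ?_⟩
  simp only at h
  interval_cases j <;> revert i <;> decide

theorem code_decode (n : ℕ) (hn : 0 < n) (a : ℕ × Fin 4) (ha : IsCode n a) :
    code n hn (decode n hn a) = a := by
  by_cases h3 : a.1 ≤ 3
  · obtain ⟨u, rfl⟩ := exists_codeH_eq a h3
    rw [decode_codeH]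
    rfl
  · rcases ha with h | rfl
    · have e : a = ((⟨a.1 - 3, by omega⟩ : Fin n).val + 3, a.2) :=
        Prod.ext (by dsimp only; omega) rfl
      rw [e, decode_strip]
      rfl
    · exact congrArg (code n hn) (decode_codeW n hn 4)

theorem isCode_code (n : ℕ) (hn : 0 < n) (v : DoubleEndedVertex graphH wheelFour n hn) :
    IsCode n (code n hn v) := by
  induction v using Quot.ind with
  | mk x =>
    rcases x with u | ⟨j, i⟩ | w
    · left
      change 3 - u.val / 4 < n + 3
      omega
    · left
      change j.val + 3 < n + 3
      omega
    · by_cases h : w = 4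
      · right
        simp [code, preCode, codeW, h]
      · left
        simp [code, preCode, codeW, h]

/-- Inside `graphH` the lists do not involve `n`, so facts about them can be decided at `n = 0`. -/
theorem layeredNbrs_codeH (n : ℕ) (u : Fin 16) (hu : 4 ≤ u.val) :
    layeredNbrs n (codeH u) = layeredNbrs 0 (codeH u) := by
  fin_cases u <;> first | rfl | simp at hu

theorem graphH_adj_iff (u v : Fin 16) (hu : 4 ≤ u.val) :
    graphH.graph.Adj u v ↔ codeH v ∈ layeredNbrs 0 (codeH u) := by
  revert u v
  simp only [graphH, SimpleGraph.fromRel_adj]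
  decide +kernel

theorem graphH_adj_corner (u v : Fin 16) (hu : u.val < 4) (hv : v.val < 4)
    (h : graphH.graph.Adj u v) :
    (codeH v).2 = (codeH u).2 + 1 ∨ (codeH u).2 = (codeH v).2 + 1 := by
  revert u v
  simp only [graphH, SimpleGraph.fromRel_adj]
  decide +kernel

theorem right_mem_layeredNbrs (n k : ℕ) (hk : k ≠ n) (i : Fin 4) :
    (k + 3, i + 1) ∈ layeredNbrs n (k + 3, i) := by
  simp [layeredNbrs, hk]

theorem codeH_mem_layeredNbrs (n : ℕ) (hn : 0 < n) (u v : Fin 16) (h : graphH.graph.Adj u v) :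
    codeH v ∈ layeredNbrs n (codeH u) := by
  have key : ∀ u v : Fin 16, 4 ≤ u.val → graphH.graph.Adj u v →
      codeH v ∈ layeredNbrs n (codeH u) := fun u v hu h => by
    rw [layeredNbrs_codeH n u hu]
    exact (graphH_adj_iff u v hu).1 h
  have hc : ∀ u : Fin 16, IsCode n (codeH u) := fun u => by
    left
    change 3 - u.val / 4 < n + 3
    omega
  by_cases hu : 4 ≤ u.val
  · exact key u v hu h
  by_cases hv : 4 ≤ v.val
  · exact mem_layeredNbrs_comm hn (hc v) (key v u hv h.symm)
  have hlow : ∀ u : Fin 16, ¬ 4 ≤ u.val → codeH u = (0 + 3, (codeH u).2) := fun u hu =>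
    Prod.ext (by change 3 - u.val / 4 = 3; omega) rfl
  rcases graphH_adj_corner u v (not_le.1 hu) (not_le.1 hv) h with e | e
  · rw [hlow u hu, hlow v hv, e]
    exact right_mem_layeredNbrs n 0 hn.ne _
  · refine mem_layeredNbrs_comm hn (hc v) ?_
    rw [hlow u hu, hlow v hv, e]
    exact right_mem_layeredNbrs n 0 hn.ne _

theorem wheelFour_adj_mem (n : ℕ) (hn : 0 < n) (u v : Fin 5) (h : wheelFour.graph.Adj u v) :
    codeW n v ∈ layeredNbrs n (codeW n u) := by
  obtain ⟨m, rfl⟩ : ∃ m, n = m + 1 := ⟨n - 1, by omega⟩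
  have : ∀ u v : Fin 5, wheelFour.graph.Adj u v → u = 4 ∧ v.val < 4 ∨ v = 4 ∧ u.val < 4 ∨
      u.val < 4 ∧ v.val < 4 ∧ (Fin.ofNat 4 v.val = Fin.ofNat 4 u.val + 1 ∨
        Fin.ofNat 4 v.val = Fin.ofNat 4 u.val + 3) := by
    simp only [wheelFour, SimpleGraph.fromRel_adj]
    decide
  have ne4 : ∀ w : Fin 5, w.val < 4 → w ≠ 4 := by decide
  rcases this u v h with ⟨rfl, hv⟩ | ⟨rfl, hu⟩ | ⟨hu, hv, e⟩
  · simp only [codeW, ne4 v hv, if_true, if_false, layeredNbrs]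
    generalize Fin.ofNat 4 v.val = i
    fin_cases i <;> simp
  · simp [codeW, ne4 u hu, layeredNbrs, nbrsBelow]
  · simp only [codeW, ne4 u hu, ne4 v hv, if_false]
    generalize Fin.ofNat 4 u.val = i at *
    generalize Fin.ofNat 4 v.val = i' at *
    rcases e with rfl | rfl <;> simp [layeredNbrs]

theorem preCode_mem_layeredNbrs (n : ℕ) (hn : 0 < n) (x y : Fin 16 ⊕ (Fin n × Fin 4) ⊕ Fin 5)
    (h : (graphH.graph ⊕g (triangularStrip n ⊕g wheelFour.graph)).Adj x y) :
    preCode n y ∈ layeredNbrs n (preCode n x) := by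
  rcases x with u | p | w <;> rcases y with u' | p' | w'
  · exact codeH_mem_layeredNbrs n hn u u' h
  · exact absurd h (by simp)
  · exact absurd h (by simp)
  · exact absurd h (by simp)
  · have key : ∀ p q : Fin n × Fin 4, ((q.1 = p.1 ∧ q.2 = p.2 + 1) ∨
        (q.1.val = p.1.val + 1 ∧ (q.2 = p.2 ∨ q.2 = p.2 + 1))) →
        (q.1.val + 3, q.2) ∈ layeredNbrs n (p.1.val + 3, p.2) := by
      rintro ⟨j, i⟩ ⟨j', i'⟩ h
      dsimp only at h ⊢
      have hj : j.val ≠ n := j.isLt.ne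
      rcases h with ⟨rfl, rfl⟩ | ⟨e, h⟩
      · exact right_mem_layeredNbrs n _ hj i
      · have hj' : j.val + 1 ≠ n := e ▸ j'.isLt.ne
        rcases h with rfl | rfl <;> simp [layeredNbrs, hj, nbrsBelow, hj', e]
    have hq : IsCode n (p'.1.val + 3, p'.2) := Or.inl (by change p'.1.val + 3 < n + 3; omega)
    rcases h with ⟨-, h | h⟩
    · exact key p p' h
    · exact mem_layeredNbrs_comm hn hq (key p' p h)
  · exact absurd h (by simp)
  · exact absurd h (by simp)
  · exact absurd h (by simp)
  · exact wheelFour_adj_mem n hn w w' h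

/-- Identified vertices have the same coordinates, while adjacent ones have coordinates in each
other's lists, and no list contains its own vertex. This supplies the hypothesis `hloop` of the
colouring count. -/
theorem mk_ne_mk_of_adj (n : ℕ) (hn : 0 < n) (x y : Fin 16 ⊕ (Fin n × Fin 4) ⊕ Fin 5)
    (h : (graphH.graph ⊕g (triangularStrip n ⊕g wheelFour.graph)).Adj x y) :
    Quot.mk (GlueRel graphH wheelFour n hn) x ≠ Quot.mk (GlueRel graphH wheelFour n hn) y := by
  intro e
  have e' : preCode n x = preCode n y := congrArg (code n hn) e
  have := preCode_mem_layeredNbrs n hn x y h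
  rw [← e'] at this
  exact notMem_layeredNbrs_self n _ this

theorem adj_mk (n : ℕ) (hn : 0 < n) {x y : Fin 16 ⊕ (Fin n × Fin 4) ⊕ Fin 5}
    (h : (graphH.graph ⊕g (triangularStrip n ⊕g wheelFour.graph)).Adj x y) :
    (doubleEnded graphH wheelFour n hn).Adj (Quot.mk _ x) (Quot.mk _ y) :=
  ⟨mk_ne_mk_of_adj n hn x y h, x, y, h, rfl, rfl⟩

theorem adj_decode_of_lt (n : ℕ) (hn : 0 < n) (a b : ℕ × Fin 4) (ha : a.1 < 3)
    (h : b ∈ layeredNbrs n a) :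
    (doubleEnded graphH wheelFour n hn).Adj (decode n hn a) (decode n hn b) := by
  obtain ⟨u, rfl⟩ := exists_codeH_eq a (by omega)
  have hu : 4 ≤ u.val := by
    have : 3 - u.val / 4 < 3 := ha
    omega
  rw [layeredNbrs_codeH n u hu] at h
  have hb : ∀ u : Fin 16, 4 ≤ u.val → ∀ b ∈ layeredNbrs 0 (codeH u), b.1 ≤ 3 := by decide +kernel
  obtain ⟨v, rfl⟩ := exists_codeH_eq b (hb u hu b h)
  rw [decode_codeH, decode_codeH]
  exact adj_mk n hn (x := .inl u) (y := .inl v) ((graphH_adj_iff u v hu).2 h)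

theorem adj_decode_hub (n : ℕ) (hn : 0 < n) (b : ℕ × Fin 4) (h : b ∈ layeredNbrs n (n + 3, 0)) :
    (doubleEnded graphH wheelFour n hn).Adj (decode n hn (n + 3, 0)) (decode n hn b) := by
  have h4 : ∀ w : Fin 5, w ≠ 4 → wheelFour.graph.Adj 4 w := by
    simp only [wheelFour, SimpleGraph.fromRel_adj]
    decide
  have : ∃ w : Fin 5, w ≠ 4 ∧ codeW n w = b := by
    simp only [layeredNbrs, if_true, List.mem_cons, List.not_mem_nil, or_false] at h
    rcases h with rfl | rfl | rfl | rfl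
    · exact ⟨0, by decide, rfl⟩
    · exact ⟨1, by decide, rfl⟩
    · exact ⟨2, by decide, rfl⟩
    · exact ⟨3, by decide, rfl⟩
  obtain ⟨w, hw, rfl⟩ := this
  have e := decode_codeW n hn 4
  rw [codeW, if_pos rfl] at e
  rw [e, decode_codeW]
  exact adj_mk n hn (x := .inr (.inr 4)) (y := .inr (.inr w)) (h4 w hw)

theorem adj_decode_strip (n : ℕ) (hn : 0 < n) (j j' : Fin n) (i i' : Fin 4)
    (h : (j'.val + 3, i') ∈ layeredNbrs n (j.val + 3, i)) :
    (doubleEnded graphH wheelFour n hn).Adj (decode n hn (j.val + 3, i))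
      (decode n hn (j'.val + 3, i')) := by
  rw [decode_strip, decode_strip]
  refine adj_mk n hn (x := .inr (.inl (j, i))) (y := .inr (.inl (j', i'))) ?_
  change (triangularStrip n).Adj (j, i) (j', i')
  refine ⟨fun e => ?_, ?_⟩
  · rw [Prod.mk.injEq] at e
    rw [e.1, e.2] at h
    exact notMem_layeredNbrs_self n _ h
  have h34 : ∀ i i' : Fin 4, i' = i + 3 → i = i' + 1 := by decide
  have hj := j.isLt
  have hj' := j'.isLt
  simp only [layeredNbrs, hj.ne, if_false, nbrsBelow, nbrsAbove] at h
  split_ifs at h with h1 h2 h2 <;>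
    simp only [List.mem_cons, List.cons_append, List.nil_append, Prod.mk.injEq, List.not_mem_nil,
      or_false] at h
  all_goals
    have := h34 i i'
    have := Fin.ext_iff (a := j') (b := j)
    have := Fin.ext_iff (a := j) (b := j')
    grind

theorem doubleEnded_adj_iff (n : ℕ) (hn : 0 < n) (u v : DoubleEndedVertex graphH wheelFour n hn) :
    (doubleEnded graphH wheelFour n hn).Adj u v ↔ code n hn v ∈ layeredNbrs n (code n hn u) := by
  constructor
  · rintro ⟨-, x, y, h, rfl, rfl⟩
    exact preCode_mem_layeredNbrs n hn x y h
  · intro h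
    have hu := isCode_code n hn u
    have hv := isCode_code n hn v
    rw [← decode_code n hn u, ← decode_code n hn v]
    generalize code n hn u = a at *
    generalize code n hn v = b at *
    have h' := mem_layeredNbrs_comm hn hu h
    by_cases ha : a.1 < 3
    · exact adj_decode_of_lt n hn a b ha h
    by_cases hb : b.1 < 3
    · exact (adj_decode_of_lt n hn b a hb h').symm
    rcases hu with hu | rfl
    · rcases hv with hv | rfl
      · have ea : a = ((⟨a.1 - 3, by omega⟩ : Fin n).val + 3, a.2) :=
          Prod.ext (by dsimp only; omega) rfl
        have eb : b = ((⟨b.1 - 3, by omega⟩ : Fin n).val + 3, b.2) :=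
          Prod.ext (by dsimp only; omega) rfl
        rw [ea, eb] at h ⊢
        exact adj_decode_strip n hn _ _ _ _ h
      · exact (adj_decode_hub n hn a h').symm
    · exact adj_decode_hub n hn b h

/-! ### Vertex count, degree sum and connectedness -/

/-- The layered coordinates of all vertices. -/
def codes (n : ℕ) : Finset (ℕ × Fin 4) :=
  insert (n + 3, 0) (Finset.range (n + 3) ×ˢ Finset.univ)

theorem mem_codes (n : ℕ) (a : ℕ × Fin 4) : a ∈ codes n ↔ IsCode n a := by
  simp [codes, IsCode, or_comm]

theorem hub_notMem (n : ℕ) :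
    ((n + 3, 0) : ℕ × Fin 4) ∉ Finset.range (n + 3) ×ˢ (Finset.univ : Finset (Fin 4)) := by
  simp

theorem finsum_code (n : ℕ) (hn : 0 < n) (f : ℕ × Fin 4 → ℕ) :
    ∑ᶠ v, f (code n hn v) = ∑ a ∈ codes n, f a := by
  classical
  have := Fintype.ofFinite (DoubleEndedVertex graphH wheelFour n hn)
  rw [finsum_eq_sum_of_fintype]
  exact Finset.sum_nbij' (code n hn) (decode n hn)
    (fun v _ => (mem_codes n _).2 (isCode_code n hn v)) (fun _ _ => Finset.mem_univ _)
    (fun v _ => decode_code n hn v) (fun a ha => code_decode n hn a ((mem_codes n a).1 ha))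
    (fun _ _ => rfl)

theorem card_doubleEndedVertex (n : ℕ) (hn : 0 < n) :
    Nat.card (DoubleEndedVertex graphH wheelFour n hn) = 4 * n + 13 := by
  classical
  have := Fintype.ofFinite (DoubleEndedVertex graphH wheelFour n hn)
  have h := finsum_code n hn fun _ => 1
  rw [finsum_eq_sum_of_fintype, ← Finset.card_eq_sum_ones, ← Finset.card_eq_sum_ones,
    Finset.card_univ, codes, Finset.card_insert_of_notMem (hub_notMem n), Finset.card_product,
    Finset.card_range, Finset.card_univ, Fintype.card_fin] at h
  rw [Nat.card_eq_fintype_card]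
  omega

theorem sum_length_layeredNbrs (n : ℕ) (hn : 0 < n) :
    ∑ a ∈ codes n, (layeredNbrs n a).length = 24 * n + 66 := by
  obtain ⟨m, rfl⟩ : ∃ m, n = m + 1 := ⟨n - 1, by omega⟩
  -- Four vertices of degree 6 in each layer, with two corrections: in the first layer each has
  -- three neighbours above instead of two, and in the last layer only the hub below instead of two
  -- vertices. The second correction stands on the left to avoid subtraction.
  have hlayer : ∀ k < m + 1, (∑ i : Fin 4, (layeredNbrs (m + 1) (k + 3, i)).length) +
      (if k = m then 4 else 0) = 24 + if k = 0 then 4 else 0 := by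
    intro k hk
    have : k ≠ m + 1 := hk.ne
    simp only [layeredNbrs, this, if_false, nbrsBelow, nbrsAbove, Nat.add_right_cancel_iff]
    split_ifs <;> simp
  have hsum := Finset.sum_congr rfl fun k hk => hlayer k (Finset.mem_range.1 hk)
  simp only [Finset.sum_add_distrib, Finset.sum_ite_eq', Finset.mem_range] at hsum
  rw [codes, Finset.sum_insert (hub_notMem _), Finset.sum_product, Finset.sum_range_succ',
    Finset.sum_range_succ', Finset.sum_range_succ']
  have h0 : ∑ i : Fin 4, (layeredNbrs (m + 1) (0, i)).length = 22 := rfl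
  have h1 : ∑ i : Fin 4, (layeredNbrs (m + 1) (1, i)).length = 20 := rfl
  have h2 : ∑ i : Fin 4, (layeredNbrs (m + 1) (2, i)).length = 20 := rfl
  have h3 : (layeredNbrs (m + 1) (m + 1 + 3, 0)).length = 4 := by simp [layeredNbrs]
  simp at hsum
  simp only [Nat.reduceAdd, add_assoc, zero_add] at *
  rw [h0, h1, h2, h3]
  omega

theorem connected_doubleEnded (n : ℕ) (hn : 0 < n) :
    (doubleEnded graphH wheelFour n hn).Connected := by
  have adj : ∀ a b, IsCode n a → b ∈ layeredNbrs n a →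
      (doubleEnded graphH wheelFour n hn).Adj (decode n hn a) (decode n hn b) := by
    intro a b ha h
    rw [doubleEnded_adj_iff, code_decode n hn a ha,
      code_decode n hn b (isCode_of_mem_layeredNbrs n hn a b ha h)]
    exact h
  have hzero : ∀ i : Fin 4, (doubleEnded graphH wheelFour n hn).Reachable
      (decode n hn (0, 0)) (decode n hn (0, i)) := by
    have step : ∀ i : Fin 4, (doubleEnded graphH wheelFour n hn).Adj
        (decode n hn (0, i)) (decode n hn (0, i + 1)) := fun i =>
      adj _ _ (Or.inl (Nat.succ_pos _)) (by simp [layeredNbrs])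
    intro i
    fin_cases i
    · exact SimpleGraph.Reachable.refl _
    · exact (step 0).reachable
    · exact (step 0).reachable.trans (step 1).reachable
    · exact ((step 0).reachable.trans (step 1).reachable).trans (step 2).reachable
  have hlayer : ∀ j, j < n + 3 → ∀ i : Fin 4, (doubleEnded graphH wheelFour n hn).Reachable
      (decode n hn (0, 0)) (decode n hn (j, i)) := by
    intro j
    induction j with
    | zero => exact fun _ => hzero
    | succ j ih =>
      intro hj i
      refine (ih (by omega) i).trans (adj (j + 1, i) (j, i) (Or.inl hj) ?_).symm.reachable
      match j with
      | 0 => simp [layeredNbrs]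
      | 1 => simp [layeredNbrs]
      | 2 => simp [layeredNbrs, hn.ne, nbrsAbove]
      | k + 3 =>
        have : k + 1 ≠ n := by omega
        simp [layeredNbrs, this, nbrsAbove]
  have hall : ∀ v, (doubleEnded graphH wheelFour n hn).Reachable (decode n hn (0, 0)) v := by
    intro v
    rw [← decode_code n hn v]
    rcases isCode_code n hn v with h | h
    · exact hlayer _ h _
    · rw [h]
      exact (hlayer (n + 2) (by omega) 0).trans
        (adj (n + 3, 0) (n + 2, 0) (Or.inr rfl) (by simp [layeredNbrs])).symm.reachable
  exact { preconnected := fun u v => (hall u).symm.trans (hall v)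
          nonempty := ⟨decode n hn (0, 0)⟩ }

theorem isPlanarTriangulation_doubleEnded (n : ℕ) (hn : 0 < n) :
    IsPlanarTriangulation (doubleEnded graphH wheelFour n hn) := by
  refine isPlanarTriangulation_of_code (code n hn) (decode n hn) (layeredNbrs n)
    (decode_code n hn)
    (fun v b hb => code_decode n hn b
      (isCode_of_mem_layeredNbrs n hn _ b (isCode_code n hn v) hb))
    (fun v => layeredNbrs_nodup n _) (doubleEnded_adj_iff n hn)
    (fun v => layeredNbrs_triangle n hn _ (isCode_code n hn v)) (connected_doubleEnded n hn) ?_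
  rw [finsum_code n hn fun a => (layeredNbrs n a).length, sum_length_layeredNbrs n hn,
    card_doubleEndedVertex]
  omega

end RotationSystem

/-! ### Assembly -/

theorem aeval_chromaticPolynomial_eq_totalValue (n : ℕ) (hn : 0 < n) (q : ℝ) :
    Polynomial.aeval q (chromaticPolynomial (doubleEnded graphH wheelFour n hn)) =
      ColorCount.totalValue q (n - 1) := by
  obtain ⟨m, rfl⟩ : ∃ m, n = m + 1 := ⟨n - 1, by omega⟩
  exact ColorCount.aeval_chromaticPolynomial_doubleEnded m
    (RotationSystem.mk_ne_mk_of_adj (m + 1) hn) q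

theorem mainTheorem1 :
    (∀ (n : ℕ) (hn : 0 < n), IsPlanarTriangulation (doubleEnded graphH wheelFour n hn)) ∧
    (∀ (n : ℕ) (hn : 0 < n),
      0 < Polynomial.aeval (4 : ℝ) (chromaticPolynomial (doubleEnded graphH wheelFour n hn))) ∧
    (∃ ε₀ : ℝ, 0 < ε₀ ∧ ∀ ε : ℝ, 0 < ε → ε < ε₀ →
      ∃ n₀ : ℕ, ∀ (n : ℕ) (hn : 0 < n), n₀ < n →
        Polynomial.aeval (4 - ε)
          (chromaticPolynomial (doubleEnded graphH wheelFour n hn)) < 0) ∧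
    (∀ δ : ℝ, 0 < δ → ∃ n₀ : ℕ, ∀ (n : ℕ) (hn : 0 < n), n₀ < n →
      ∃ x : ℝ, 4 - δ < x ∧ x < 4 ∧
        Polynomial.aeval x (chromaticPolynomial (doubleEnded graphH wheelFour n hn)) = 0) := by
  simp only [aeval_chromaticPolynomial_eq_totalValue]
  refine ⟨RotationSystem.isPlanarTriangulation_doubleEnded,
    fun n _ => ColorCount.totalValue_four_pos _, ?_, fun δ hδ => ?_⟩
  · obtain ⟨ε₀, h0, h⟩ := ColorCount.exists_totalValue_neg
    refine ⟨ε₀, h0, fun ε hε hε' => ?_⟩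
    obtain ⟨N, hN⟩ := h ε hε hε'
    -- A strip of `n` layers takes `n - 1` transfer steps, hence the shift of the threshold.
    exact ⟨N + 1, fun n _ hn => hN _ (by omega)⟩
  · obtain ⟨N, hN⟩ := ColorCount.exists_root δ hδ
    exact ⟨N + 1, fun n _ hn => hN _ (by omega)⟩
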